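/- For positive integers $\alpha_1,\dots,\alpha_r$ with $\alpha_r\ge 2$ let $$\zeta(\alpha_1,\dots,\alpha_r)=\sum_{1\le k_1<k_2<\cdots<k_r}k_1^{-\alpha_1}k_2^{-\alpha_2}\cdots k_r^{-\alpha_r}$$ be the multiple zeta value (so that $\zeta(s)$ is the Riemann zeta value when $r=1$). Then for every integer $p\ge 0$, $$\sum_{a+b+c=p}\left(\sum_{|\boldsymbol\alpha|=a+b+1}\zeta(\alpha_0,\dots,\alpha_{a-1},\alpha_a+1,c+2)+\sum_{|\boldsymbol\beta|=b+c+1}\zeta(a+2,\beta_0,\dots,\beta_{b-1},\beta_b+1)\right)=\frac{p+2}{2}\sum_{m+n=p}\zeta(m+2)\zeta(n+2)-\frac{(p+1)(p+2)}{2}\zeta(p+4).$$ Here $a,b,c,m,n$ range over the nonnegative integers, $\boldsymbol\alpha=(\alpha_0,\dots,\alpha_a)$ ranges over the $(a+1)$-tuples of positive integers with $\alpha_0+\cdots+\alpha_a=a+b+1$, and $\boldsymbol\beta=(\beta_0,\dots,\beta_b)$ over the $(b+1)$-tuples of positive integers with $\beta_0+\cdots+\beta_b=b+c+1$. -/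

import Mathlib

/-- The strictly increasing `r`-tuples `1 ≤ k₁ < k₂ < ⋯ < k_r` of positive integers. -/
abbrev IncTuple (r : ℕ) : Type :=
  {k : Fin r → ℕ // (∀ i, 1 ≤ k i) ∧ StrictMono k}

/-- The multiple zeta value
`ζ(α₁, …, α_r) = ∑_{1 ≤ k₁ < ⋯ < k_r} k₁ ^ (-α₁) ⋯ k_r ^ (-α_r)`. -/
noncomputable def multiZeta {r : ℕ} (α : Fin r → ℕ) : ℝ :=
  ∑' k : IncTuple r, ∏ i, ((k.1 i : ℝ) ^ α i)⁻¹

/-- The `r`-tuples of positive integers with sum `n`. -/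
def posTuples (r n : ℕ) : Finset (Fin r → ℕ) :=
  (Finset.Nat.antidiagonalTuple r n).filter (fun α => ∀ i, 1 ≤ α i)

/-- `(α₀, …, α_{a-1}, α_a) ↦ (α₀, …, α_{a-1}, α_a + 1)`. -/
def bumpLast {a : ℕ} (α : Fin (a + 1) → ℕ) : Fin (a + 1) → ℕ :=
  Function.update α (Fin.last a) (α (Fin.last a) + 1)

theorem mem_posTuples {r n : ℕ} (α : Fin r → ℕ) :
    α ∈ posTuples r n ↔ (∑ i, α i = n) ∧ ∀ i, 1 ≤ α i := by
  simp [posTuples, Finset.Nat.mem_antidiagonalTuple]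

theorem summable_pi_prod_of_nonneg {f : ℕ → ℝ} (hf : Summable f) (h0 : ∀ n, 0 ≤ f n) (r : ℕ) :
    Summable (fun k : Fin r → ℕ => ∏ i, f (k i)) := by
  induction r with
  | zero => exact (hasSum_fintype _).summable
  | succ r ih =>
    rw [← (Fin.consEquiv (fun _ : Fin (r + 1) => ℕ)).summable_iff]
    have := hf.mul_of_nonneg ih h0 (fun k => Finset.prod_nonneg fun i _ => h0 _)
    refine this.congr ?_
    rintro ⟨n, k⟩
    simp [Fin.consEquiv, Fin.prod_univ_succ]

/-- The series of a multiple zeta value converges (absolutely) whenever the entries are positive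
and the last one is at least two. -/
theorem summable_multiZeta {r : ℕ} (α : Fin (r + 1) → ℕ) (h1 : ∀ i, 1 ≤ α i)
    (h2 : 2 ≤ α (Fin.last r)) :
    Summable (fun k : IncTuple (r + 1) => ∏ i, ((k.1 i : ℝ) ^ α i)⁻¹) := by
  set e : ℝ := 1 / ((r : ℝ) + 1) with he
  have hr : (0 : ℝ) < (r : ℝ) + 1 := by positivity
  have he0 : 0 < e := by positivity
  have hs : Summable (fun n : ℕ => ((n : ℝ) ^ (1 + e))⁻¹) :=
    Real.summable_nat_rpow_inv.mpr (by linarith)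
  have hpi := summable_pi_prod_of_nonneg hs (fun n => by positivity) (r + 1)
  have hsub : Summable (fun k : IncTuple (r + 1) => ∏ i, (((k.1 i : ℕ) : ℝ) ^ (1 + e))⁻¹) :=
    hpi.comp_injective (i := fun k : IncTuple (r + 1) => k.1) Subtype.val_injective
  refine Summable.of_nonneg_of_le (fun k => Finset.prod_nonneg fun i _ => by positivity)
    (fun k => ?_) hsub
  obtain ⟨k, hk, hm⟩ := k
  have hk1 : ∀ i, (1 : ℝ) ≤ k i := fun i => by exact_mod_cast hk i
  have hk0 : ∀ i, (0 : ℝ) < k i := fun i => lt_of_lt_of_le one_pos (hk1 i)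
  have hle : ∀ i, (k i : ℝ) ≤ k (Fin.last r) := fun i => by
    exact_mod_cast hm.monotone (Fin.le_last i)
  simp only [Finset.prod_inv_distrib]
  refine inv_anti₀ (Finset.prod_pos fun i _ => Real.rpow_pos_of_pos (hk0 i) _) ?_
  calc ∏ i, (k i : ℝ) ^ (1 + e) = (∏ i, (k i : ℝ)) * ∏ i, (k i : ℝ) ^ e := by
        rw [← Finset.prod_mul_distrib]
        refine Finset.prod_congr rfl fun i _ => ?_
        rw [Real.rpow_add (hk0 i), Real.rpow_one]
    _ ≤ (∏ i, (k i : ℝ)) * ∏ _i : Fin (r + 1), (k (Fin.last r) : ℝ) ^ e := by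
        refine mul_le_mul_of_nonneg_left ?_ (Finset.prod_nonneg fun i _ => (hk0 i).le)
        exact Finset.prod_le_prod (fun i _ => by positivity)
          fun i _ => Real.rpow_le_rpow (hk0 i).le (hle i) he0.le
    _ = (∏ i, (k i : ℝ)) * (k (Fin.last r) : ℝ) := by
        congr 1
        rw [Finset.prod_const, Finset.card_univ, Fintype.card_fin, ← Real.rpow_natCast,
          ← Real.rpow_mul (hk0 _).le]
        have : e * ((r + 1 : ℕ) : ℝ) = 1 := by
          rw [he]; push_cast; field_simp
        rw [this, Real.rpow_one]
    _ = (∏ i : Fin r, (k i.castSucc : ℝ)) * (k (Fin.last r) : ℝ) ^ 2 := by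
        rw [Fin.prod_univ_castSucc]; ring
    _ ≤ (∏ i : Fin r, (k i.castSucc : ℝ) ^ α i.castSucc) *
          (k (Fin.last r) : ℝ) ^ α (Fin.last r) := by
        refine mul_le_mul ?_ (pow_le_pow_right₀ (hk1 _) h2) (by positivity)
          (Finset.prod_nonneg fun i _ => by positivity)
        refine Finset.prod_le_prod (fun i _ => (hk0 _).le) fun i _ => ?_
        exact le_self_pow₀ (hk1 _) (by have := h1 i.castSucc; omega)
    _ = ∏ i, (k i : ℝ) ^ α i := by rw [Fin.prod_univ_castSucc]

/-- In depth one the multiple zeta value is the value of the Riemann zeta function. -/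
theorem multiZeta_singleton (s : ℕ) (hs : 2 ≤ s) :
    (multiZeta ![s] : ℂ) = riemannZeta s := by
  let φ : ℕ ≃ IncTuple 1 :=
    { toFun := fun n => ⟨fun _ => n + 1, fun _ => Nat.le_add_left 1 n, Subsingleton.strictMono _⟩
      invFun := fun k => k.1 0 - 1
      left_inv := fun n => by simp
      right_inv := fun k => by
        apply Subtype.ext
        funext i
        have := k.2.1 0
        rw [Subsingleton.elim i 0]
        simp only
        omega }
  have hz := zeta_eq_tsum_one_div_nat_add_one_cpow (s := (s : ℂ)) (by
    rw [Complex.natCast_re]; exact_mod_cast hs)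
  rw [hz, multiZeta, ← φ.tsum_eq, Complex.ofReal_tsum]
  refine tsum_congr fun n => ?_
  simp [φ]

/-! Multiply the identity by `x ^ p`, for `0 ≤ x ≤ 1/2`, and sum over `p`. Summing over all
exponents at a fixed index `j` is a geometric series, so an optional index `j` contributes `1 +
x/(j-x) = j/(j-x)`, and an obligatory index with exponent at least 2 contributes `1/(j(j-x))`. With
`γ(m) = ∏_{j≤m} j/(j-x)`, the two families on the left become A = `∑_{k<l} γ(k)/k² · 1/(l(l-x))` and
B = `∑_{m<k} 1/(m(m-x)) · γ(k)/(γ(m) k²)`.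

The heart is a connected-sum argument: A = `∑_{k<l} 1/(k(k-x)) · 1/(l-x)²`
(`tsum_gammaKernel_zero_mul_tsum`) and B = `∑_{k<l} 1/(k-x)² · 1/(l(l-x))`
(`tsum_mul_tsum_gammaKernel_zero`). Two kernels in `(m, n)`, quotients of gamma values, telescope in
each variable after division by a suitable linear factor. Thus a factor on the `m` side can be
traded for a summation on the `n` side and conversely, until the kernel is reduced to its boundary
value 1.

A and B are then the two off-diagonal parts of `(∑ 1/(k(k-x))) (∑ 1/(k-x)²)`; the diagonal is `∑
1/(k(k-x)³)`. Expanding in `x` gives the coefficients `ζ(p+2)`, `(p+1) ζ(p+2)` and `C(p+2,2)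
ζ(p+4)`, and symmetrizing the Cauchy product gives the factor `(p+2)/2`. All terms are nonnegative,
so the sums live in `ENNReal`, where interchanging them needs no justification; finiteness is needed
only when coefficients are compared. -/

open Filter Topology

/-! ### Telescoping series and the two connecting kernels -/

/-- A telescoping series of nonnegative terms. -/
theorem tsum_Ioi_ofReal_telescope {f g : ℕ → ℝ} (q : ℕ) (hf : ∀ n, q ≤ n → 0 ≤ f (n + 1))
    (hfg : ∀ n, q ≤ n → f (n + 1) = g n - g (n + 1)) (hg : Tendsto g atTop (𝓝 0)) :
    ∑' n : Set.Ioi q, ENNReal.ofReal (f n) = ENNReal.ofReal (g q) := by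
  let e : ℕ ≃ Set.Ioi q :=
    { toFun := fun j => ⟨q + j + 1, by simp only [Set.mem_Ioi]; omega⟩
      invFun := fun n => n - q - 1
      left_inv := fun j => by simp only; omega
      right_inv := fun n => by
        have := n.2
        simp only [Set.mem_Ioi] at this
        apply Subtype.ext
        simp only
        omega }
  rw [← e.tsum_eq]
  have h : HasSum (fun j => f (q + j + 1)) (g q) := by
    rw [hasSum_iff_tendsto_nat_of_nonneg fun j => hf _ (Nat.le_add_right _ _)]
    have h1 : ∀ n, ∑ j ∈ Finset.range n, f (q + j + 1) = g q - g (q + n) := fun n => by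
      induction n with
      | zero => simp
      | succ n ih =>
        rw [Finset.sum_range_succ, ih, hfg _ (Nat.le_add_right _ _)]
        simp [add_assoc]
    simp only [h1]
    have h2 : Tendsto (fun n => g (q + n)) atTop (𝓝 0) := by
      simpa [add_comm] using (tendsto_add_atTop_iff_nat q).2 hg
    simpa using h2.const_sub (g q)
  rw [← h.tsum_eq, ENNReal.ofReal_tsum_of_nonneg (fun j => hf _ (Nat.le_add_right _ _)) h.summable]
  rfl

/-- The quotient `∏_{j=1}^m (j - x) / (n + j - x)` of gamma values, which is symmetric in `m`
and `n`. -/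
noncomputable def betaKernel (x : ℝ) (m n : ℕ) : ℝ :=
  ∏ j ∈ Finset.range m, ((j : ℝ) + 1 - x) / ((n : ℝ) + j + 1 - x)

/-- The quotient `∏_{j=1}^m j / (n + j - x)` of gamma values. -/
noncomputable def gammaKernel (x : ℝ) (m n : ℕ) : ℝ :=
  ∏ j ∈ Finset.range m, ((j : ℝ) + 1) / ((n : ℝ) + j + 1 - x)

section Kernels

variable {x : ℝ}

theorem betaKernel_pos (hx : x < 1) (m n : ℕ) : 0 < betaKernel x m n :=
  Finset.prod_pos fun j _ => by
    have hj : (0 : ℝ) ≤ j := j.cast_nonneg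
    have hn : (0 : ℝ) ≤ n := n.cast_nonneg
    exact div_pos (by linarith) (by linarith)

theorem gammaKernel_pos (hx : x < 1) (m n : ℕ) : 0 < gammaKernel x m n :=
  Finset.prod_pos fun j _ => by
    have hj : (0 : ℝ) ≤ j := j.cast_nonneg
    have hn : (0 : ℝ) ≤ n := n.cast_nonneg
    exact div_pos (by linarith) (by linarith)

theorem betaKernel_succ_left (x : ℝ) (m n : ℕ) :
    betaKernel x (m + 1) n = betaKernel x m n * (((m : ℝ) + 1 - x) / ((n : ℝ) + m + 1 - x)) :=
  Finset.prod_range_succ _ _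

theorem gammaKernel_succ_left (x : ℝ) (m n : ℕ) :
    gammaKernel x (m + 1) n = gammaKernel x m n * (((m : ℝ) + 1) / ((n : ℝ) + m + 1 - x)) :=
  Finset.prod_range_succ _ _

theorem betaKernel_zero_left (x : ℝ) (n : ℕ) : betaKernel x 0 n = 1 := by simp [betaKernel]

theorem gammaKernel_zero_left (x : ℝ) (n : ℕ) : gammaKernel x 0 n = 1 := by simp [gammaKernel]

theorem betaKernel_zero_right (hx : x < 1) (m : ℕ) : betaKernel x m 0 = 1 :=
  Finset.prod_eq_one fun j _ => by
    have hj : (0 : ℝ) ≤ j := j.cast_nonneg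
    rw [Nat.cast_zero, zero_add, div_self]
    linarith

/-- The two kernels differ by a factor free of `n`. Hence relations in `n` pass from one to the
other, and the weight `gammaKernel x m 0` can be absorbed or released during transport. -/
theorem gammaKernel_eq_mul (hx : x < 1) (m n : ℕ) :
    gammaKernel x m n = gammaKernel x m 0 * betaKernel x m n := by
  rw [gammaKernel, gammaKernel, betaKernel, ← Finset.prod_mul_distrib]
  refine Finset.prod_congr rfl fun j _ => ?_
  have hj : (0 : ℝ) ≤ j := j.cast_nonneg
  have : (j : ℝ) + 1 - x ≠ 0 := by linarith
  rw [Nat.cast_zero, zero_add, div_mul_div_cancel₀ this]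

/-- This is the recursion of the gamma quotient in its second argument, cross-multiplied. The
product runs over the first argument, hence the induction on `m`. -/
theorem betaKernel_succ_right (hx : x < 1) (m n : ℕ) :
    betaKernel x m (n + 1) * ((n : ℝ) + 1 + m - x) = betaKernel x m n * ((n : ℝ) + 1 - x) := by
  have hn : (0 : ℝ) ≤ n := n.cast_nonneg
  induction m with
  | zero => simp [betaKernel]
  | succ m ih =>
    have hm : (0 : ℝ) ≤ m := m.cast_nonneg
    rw [betaKernel_succ_left, betaKernel_succ_left]
    have h1 : (n : ℝ) + m + 1 - x ≠ 0 := by linarith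
    have h2 : ((n : ℝ) + 1 + m + 1 - x) ≠ 0 := by linarith
    push_cast
    field_simp
    linear_combination ((m : ℝ) + 1 - x) * (n + m + 2 - x) * ih

theorem gammaKernel_succ_right (hx : x < 1) (m n : ℕ) :
    gammaKernel x m (n + 1) * ((n : ℝ) + 1 + m - x) = gammaKernel x m n * ((n : ℝ) + 1 - x) := by
  rw [gammaKernel_eq_mul hx m, gammaKernel_eq_mul hx m n, mul_assoc, mul_assoc,
    betaKernel_succ_right hx]

theorem betaKernel_le_one (hx : x < 1) (m n : ℕ) : betaKernel x m n ≤ 1 :=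
  Finset.prod_le_one (fun j _ => by
    have hj : (0 : ℝ) ≤ j := j.cast_nonneg
    have hn : (0 : ℝ) ≤ n := n.cast_nonneg
    exact (div_pos (by linarith) (by linarith)).le) fun j _ => by
    have hj : (0 : ℝ) ≤ j := j.cast_nonneg
    have hn : (0 : ℝ) ≤ n := n.cast_nonneg
    rw [div_le_one (by linarith)]
    linarith

/-- The last factor is `O(1/n)` and the others are at most 1; for `m = 0` the kernel is constantly
1. -/
theorem tendsto_betaKernel_right (hx : x < 1) {m : ℕ} (hm : 0 < m) :
    Tendsto (fun n => betaKernel x m n) atTop (𝓝 0) := by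
  obtain ⟨m, rfl⟩ := Nat.exists_eq_succ_of_ne_zero hm.ne'
  have hm : (0 : ℝ) ≤ m := m.cast_nonneg
  have h : Tendsto (fun n : ℕ => ((m : ℝ) + 1 - x) / ((n : ℝ) + m + 1 - x)) atTop (𝓝 0) := by
    refine Tendsto.div_atTop tendsto_const_nhds ?_
    simp only [add_sub_assoc, add_assoc]
    exact tendsto_atTop_add_const_right _ _ tendsto_natCast_atTop_atTop
  refine squeeze_zero (fun n => (betaKernel_pos hx _ n).le) (fun n => ?_) h
  have hn : (0 : ℝ) ≤ n := n.cast_nonneg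
  rw [Nat.succ_eq_add_one, betaKernel_succ_left]
  exact mul_le_of_le_one_left (div_pos (by linarith) (by linarith)).le (betaKernel_le_one hx m n)

/-- The true decay is of order `m ^ (-(n-x))`, and `n - x ≥ 1/2` here. The squared bound is
inductive because `(m + 3/2)² ≥ (m + 1)(m + 2)`; this is where `x ≤ 1/2` enters. -/
theorem gammaKernel_sq_le (hx : x ≤ 1 / 2) {n : ℕ} (hn : 0 < n) (m : ℕ) :
    gammaKernel x m n ^ 2 ≤ 1 / ((m : ℝ) + 1) := by
  have hn : (1 : ℝ) ≤ n := by exact_mod_cast hn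
  induction m with
  | zero => simp [gammaKernel]
  | succ m ih =>
    have hm : (0 : ℝ) ≤ m := m.cast_nonneg
    rw [gammaKernel_succ_left, mul_pow]
    refine (mul_le_mul_of_nonneg_right ih (sq_nonneg _)).trans ?_
    have h : (m : ℝ) + 1 + 1 / 2 ≤ n + m + 1 - x := by linarith
    rw [div_pow, div_mul_div_comm, div_le_div_iff₀ (mul_pos (by positivity) (pow_pos (by linarith) 2))
      (by push_cast; positivity)]
    push_cast
    have := pow_le_pow_left₀ (by positivity) h 2
    nlinarith

theorem tendsto_gammaKernel_left (hx : x ≤ 1 / 2) {n : ℕ} (hn : 0 < n) :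
    Tendsto (fun m => gammaKernel x m n) atTop (𝓝 0) := by
  have h := squeeze_zero (fun m => sq_nonneg _) (gammaKernel_sq_le hx hn)
    tendsto_one_div_add_atTop_nhds_zero_nat
  have h' := h.sqrt
  simpa [Real.sqrt_sq (gammaKernel_pos (show x < 1 by linarith) _ _).le] using h'

theorem tendsto_gammaKernel_right (hx : x < 1) {m : ℕ} (hm : 0 < m) :
    Tendsto (fun n => gammaKernel x m n) atTop (𝓝 0) := by
  have h := (tendsto_betaKernel_right hx hm).const_mul (gammaKernel x m 0)
  rw [mul_zero] at h
  exact h.congr fun n => (gammaKernel_eq_mul hx m n).symm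

theorem betaKernel_le_gammaKernel (hx0 : 0 ≤ x) (hx : x < 1) (m n : ℕ) :
    betaKernel x m n ≤ gammaKernel x m n :=
  Finset.prod_le_prod (fun j _ => by
    have hj : (0 : ℝ) ≤ j := j.cast_nonneg
    have hn : (0 : ℝ) ≤ n := n.cast_nonneg
    exact (div_pos (by linarith) (by linarith)).le) fun j _ => by
    have hj : (0 : ℝ) ≤ j := j.cast_nonneg
    have hn : (0 : ℝ) ≤ n := n.cast_nonneg
    exact div_le_div_of_nonneg_right (by linarith) (by linarith)

theorem tendsto_betaKernel_left (hx0 : 0 ≤ x) (hx : x ≤ 1 / 2) {n : ℕ} (hn : 0 < n) :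
    Tendsto (fun m => betaKernel x m n) atTop (𝓝 0) :=
  squeeze_zero (fun m => (betaKernel_pos (by linarith) m n).le)
    (fun m => betaKernel_le_gammaKernel hx0 (by linarith) m n) (tendsto_gammaKernel_left hx hn)

/-- The first of four transport relations, one for each kernel and variable. Each holds because the
summand is a difference of consecutive kernel values divided by a linear factor in the other
variable. -/
theorem tsum_betaKernel_right (hx : x < 1) {m : ℕ} (hm : 0 < m) (q : ℕ) :
    ∑' n : Set.Ioi q, ENNReal.ofReal (betaKernel x m n / ((n : ℕ) - x)) =
      ENNReal.ofReal (betaKernel x m q / m) := by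
  have hm' : (0 : ℝ) < m := by exact_mod_cast hm
  refine tsum_Ioi_ofReal_telescope (f := fun n => betaKernel x m n / ((n : ℕ) - x))
    (g := fun n => betaKernel x m n / m) q (fun n _ => ?_) (fun n _ => ?_) ?_
  · have hn : (0 : ℝ) ≤ n := n.cast_nonneg
    exact div_nonneg (betaKernel_pos hx _ _).le (by push_cast; linarith)
  · have hn : (0 : ℝ) ≤ n := n.cast_nonneg
    have h1 : (n : ℝ) + 1 - x ≠ 0 := by linarith
    push_cast
    field_simp
    linear_combination betaKernel_succ_right hx m n
  · simpa using (tendsto_betaKernel_right hx hm).div_const (m : ℝ)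

theorem tsum_gammaKernel_right (hx : x < 1) {m : ℕ} (hm : 0 < m) (q : ℕ) :
    ∑' n : Set.Ioi q, ENNReal.ofReal (gammaKernel x m n / ((n : ℕ) - x)) =
      ENNReal.ofReal (gammaKernel x m q / m) := by
  have hm' : (0 : ℝ) < m := by exact_mod_cast hm
  refine tsum_Ioi_ofReal_telescope (f := fun n => gammaKernel x m n / ((n : ℕ) - x))
    (g := fun n => gammaKernel x m n / m) q (fun n _ => ?_) (fun n _ => ?_) ?_
  · have hn : (0 : ℝ) ≤ n := n.cast_nonneg
    exact div_nonneg (gammaKernel_pos hx _ _).le (by push_cast; linarith)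
  · have hn : (0 : ℝ) ≤ n := n.cast_nonneg
    have h1 : (n : ℝ) + 1 - x ≠ 0 := by linarith
    push_cast
    field_simp
    linear_combination gammaKernel_succ_right hx m n
  · simpa using (tendsto_gammaKernel_right hx hm).div_const (m : ℝ)

theorem tsum_betaKernel_left (hx0 : 0 ≤ x) (hx : x ≤ 1 / 2) {n : ℕ} (hn : 0 < n) (q : ℕ) :
    ∑' m : Set.Ioi q, ENNReal.ofReal (betaKernel x m n / ((m : ℕ) - x)) =
      ENNReal.ofReal (betaKernel x q n / n) := by
  have hn' : (0 : ℝ) < n := by exact_mod_cast hn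
  refine tsum_Ioi_ofReal_telescope (f := fun m => betaKernel x m n / ((m : ℕ) - x))
    (g := fun m => betaKernel x m n / n) q (fun m _ => ?_) (fun m _ => ?_) ?_
  · have hm : (0 : ℝ) ≤ m := m.cast_nonneg
    exact div_nonneg (betaKernel_pos (by linarith) _ _).le (by push_cast; linarith)
  · have hm : (0 : ℝ) ≤ m := m.cast_nonneg
    have h1 : (m : ℝ) + 1 - x ≠ 0 := by linarith
    have h2 : (n : ℝ) + m + 1 - x ≠ 0 := by linarith
    rw [betaKernel_succ_left]
    push_cast
    field_simp
    ring
  · simpa using (tendsto_betaKernel_left hx0 hx hn).div_const (n : ℝ)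

theorem tsum_gammaKernel_left (hx : x ≤ 1 / 2) {n : ℕ} (hn : 0 < n) (q : ℕ) :
    ∑' m : Set.Ioi q, ENNReal.ofReal (gammaKernel x m n / (m : ℕ)) =
      ENNReal.ofReal (gammaKernel x q n / (n - x)) := by
  have hn' : (1 : ℝ) ≤ n := by exact_mod_cast hn
  have hnx : (n : ℝ) - x ≠ 0 := by linarith
  refine tsum_Ioi_ofReal_telescope (f := fun m => gammaKernel x m n / (m : ℕ))
    (g := fun m => gammaKernel x m n / (n - x)) q (fun m _ => ?_) (fun m _ => ?_) ?_
  · exact div_nonneg (gammaKernel_pos (by linarith) _ _).le (Nat.cast_nonneg _)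
  · have hm : (0 : ℝ) ≤ m := m.cast_nonneg
    have h1 : (m : ℝ) + 1 ≠ 0 := by linarith
    have h2 : (n : ℝ) + m + 1 - x ≠ 0 := by linarith
    rw [gammaKernel_succ_left]
    push_cast
    field_simp
    ring
  · simpa using (tendsto_gammaKernel_left hx hn).div_const ((n : ℝ) - x)

theorem sub_pos_of_mem_Ioi (hx : x < 1) {q : ℕ} (n : Set.Ioi q) : 0 < (((n : ℕ) : ℝ) - x) := by
  have h : (1 : ℝ) ≤ ((n : ℕ) : ℝ) := by exact_mod_cast Nat.one_le_of_lt n.2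
  linarith

theorem pos_of_mem_Ioi {q : ℕ} (n : Set.Ioi q) : 0 < (n : ℕ) := Nat.zero_lt_of_lt n.2

/-! ### Transport of double series along the kernels -/

/-- Transport of the sum `∑_{k<l} 1 / (l (l - x))` along the kernel. -/
theorem tsum_Ioi_inv_mul_sub (hx0 : 0 ≤ x) (hx : x ≤ 1 / 2) (k : ℕ) :
    ∑' l : Set.Ioi k, ENNReal.ofReal (1 / ((l : ℕ) * ((l : ℕ) - x))) =
      ∑' n : Set.Ioi 0, ENNReal.ofReal (betaKernel x k n / ((n : ℕ) * ((n : ℕ) - x))) := by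
  have hx1 : x < 1 := by linarith
  -- Write `1/l` as `betaKernel x l 0 / l`, open it into a sum over `n`, and after the interchange
  -- telescope in `l`.
  calc _ = ∑' l : Set.Ioi k, ∑' n : Set.Ioi 0, ENNReal.ofReal (1 / ((l : ℕ) - x)) *
          ENNReal.ofReal (betaKernel x l n / ((n : ℕ) - x)) := tsum_congr fun l => by
        rw [ENNReal.tsum_mul_left, tsum_betaKernel_right hx1 (pos_of_mem_Ioi l),
          betaKernel_zero_right hx1, ← ENNReal.ofReal_mul
            (one_div_nonneg.2 (sub_pos_of_mem_Ioi hx1 l).le)]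
        congr 1
        rw [div_mul_div_comm, mul_one, mul_comm]
    _ = ∑' n : Set.Ioi 0, ∑' l : Set.Ioi k, ENNReal.ofReal (1 / ((n : ℕ) - x)) *
          ENNReal.ofReal (betaKernel x l n / ((l : ℕ) - x)) := by
        rw [ENNReal.tsum_comm]
        refine tsum_congr fun n => tsum_congr fun l => ?_
        rw [← ENNReal.ofReal_mul (one_div_nonneg.2 (sub_pos_of_mem_Ioi hx1 l).le),
          ← ENNReal.ofReal_mul (one_div_nonneg.2 (sub_pos_of_mem_Ioi hx1 n).le)]
        congr 1
        ring
    _ = _ := tsum_congr fun n => by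
        rw [ENNReal.tsum_mul_left, tsum_betaKernel_left hx0 hx (pos_of_mem_Ioi n),
          ← ENNReal.ofReal_mul (one_div_nonneg.2 (sub_pos_of_mem_Ioi hx1 n).le)]
        congr 1
        rw [div_mul_div_comm, one_mul, mul_comm (((n : ℕ) : ℝ) - x)]

theorem tsum_gammaKernel_zero_mul_tsum (hx0 : 0 ≤ x) (hx : x ≤ 1 / 2) :
    ∑' k : Set.Ioi 0, ENNReal.ofReal (gammaKernel x k 0 / ((k : ℕ) : ℝ) ^ 2) *
        ∑' l : Set.Ioi (k : ℕ), ENNReal.ofReal (1 / ((l : ℕ) * ((l : ℕ) - x))) =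
      ∑' k : Set.Ioi 0, ENNReal.ofReal (1 / ((k : ℕ) * ((k : ℕ) - x))) *
        ∑' l : Set.Ioi (k : ℕ), ENNReal.ofReal (1 / ((l : ℕ) - x) ^ 2) := by
  have hx1 : x < 1 := by linarith
  -- After the inner sum is transported, one factor `1/k` opens `betaKernel x k n` into a sum over
  -- `n' > n`. The weight in `k` turns the kernel into `gammaKernel x k n'`, and the other `1/k` is
  -- what its telescoping in `k` requires.
  calc _ = ∑' k : Set.Ioi 0, ∑' n : Set.Ioi 0,
          ENNReal.ofReal (1 / ((n : ℕ) * ((n : ℕ) - x))) *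
          ∑' n' : Set.Ioi (n : ℕ), ENNReal.ofReal (1 / ((n' : ℕ) - x)) *
            ENNReal.ofReal (gammaKernel x k n' / (k : ℕ)) := tsum_congr fun k => by
        rw [tsum_Ioi_inv_mul_sub hx0 hx, ← ENNReal.tsum_mul_left]
        refine tsum_congr fun n => ?_
        have hn := sub_pos_of_mem_Ioi hx1 n
        have hk := gammaKernel_pos hx1 k 0
        have h : ∀ n' : Set.Ioi (n : ℕ), ENNReal.ofReal (1 / ((n' : ℕ) - x)) *
            ENNReal.ofReal (gammaKernel x k n' / (k : ℕ)) =
            ENNReal.ofReal (gammaKernel x k 0 / (k : ℕ)) *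
              ENNReal.ofReal (betaKernel x k n' / ((n' : ℕ) - x)) := fun n' => by
          rw [← ENNReal.ofReal_mul (one_div_nonneg.2 (sub_pos_of_mem_Ioi hx1 n').le),
            ← ENNReal.ofReal_mul (by positivity), gammaKernel_eq_mul hx1 k n']
          congr 1
          ring
        rw [tsum_congr h, ENNReal.tsum_mul_left, tsum_betaKernel_right hx1 (pos_of_mem_Ioi k),
          ← ENNReal.ofReal_mul (by positivity), ← ENNReal.ofReal_mul (by positivity),
          ← ENNReal.ofReal_mul (by positivity)]
        congr 1
        ring
    _ = ∑' n : Set.Ioi 0, ENNReal.ofReal (1 / ((n : ℕ) * ((n : ℕ) - x))) *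
          ∑' n' : Set.Ioi (n : ℕ), ENNReal.ofReal (1 / ((n' : ℕ) - x)) *
            ∑' k : Set.Ioi 0, ENNReal.ofReal (gammaKernel x k n' / (k : ℕ)) := by
        rw [ENNReal.tsum_comm]
        refine tsum_congr fun n => ?_
        rw [ENNReal.tsum_mul_left, ENNReal.tsum_comm]
        simp only [ENNReal.tsum_mul_left]
    _ = _ := tsum_congr fun n => by
        congr 1
        refine tsum_congr fun n' => ?_
        rw [tsum_gammaKernel_left hx (pos_of_mem_Ioi n'), gammaKernel_zero_left,
          ← ENNReal.ofReal_mul (one_div_nonneg.2 (sub_pos_of_mem_Ioi hx1 n').le)]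
        congr 1
        rw [div_mul_div_comm, one_mul, sq]

theorem tsum_mul_tsum_gammaKernel_zero (hx0 : 0 ≤ x) (hx : x ≤ 1 / 2) :
    ∑' m : Set.Ioi 0, ENNReal.ofReal (1 / ((m : ℕ) * ((m : ℕ) - x))) *
        ∑' k : Set.Ioi (m : ℕ),
          ENNReal.ofReal (gammaKernel x k 0 / gammaKernel x m 0 / ((k : ℕ) : ℝ) ^ 2) =
      ∑' k : Set.Ioi 0, ENNReal.ofReal (1 / ((k : ℕ) - x) ^ 2) *
        ∑' l : Set.Ioi (k : ℕ), ENNReal.ofReal (1 / ((l : ℕ) * ((l : ℕ) - x))) := by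
  have hx1 : x < 1 := by linarith
  -- One `1/k` opens `gammaKernel x k 0` into a sum over `n`, the other closes the sum over `k > m`;
  -- dividing by `gammaKernel x m 0` leaves `betaKernel`.
  have key : ∀ m : Set.Ioi 0, ∑' k : Set.Ioi (m : ℕ),
      ENNReal.ofReal (gammaKernel x k 0 / gammaKernel x m 0 / ((k : ℕ) : ℝ) ^ 2) =
      ∑' n : Set.Ioi 0, ENNReal.ofReal (betaKernel x m n / ((n : ℕ) - x) ^ 2) := fun m => by
    have hm := gammaKernel_pos hx1 m 0
    calc _ = ∑' k : Set.Ioi (m : ℕ), ∑' n : Set.Ioi 0,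
            ENNReal.ofReal (1 / gammaKernel x m 0 / (k : ℕ)) *
              ENNReal.ofReal (gammaKernel x k n / ((n : ℕ) - x)) := tsum_congr fun k => by
          rw [ENNReal.tsum_mul_left, tsum_gammaKernel_right hx1 (pos_of_mem_Ioi k),
            ← ENNReal.ofReal_mul (by positivity)]
          congr 1
          ring
      _ = ∑' n : Set.Ioi 0, ∑' k : Set.Ioi (m : ℕ),
            ENNReal.ofReal (1 / gammaKernel x m 0 / ((n : ℕ) - x)) *
              ENNReal.ofReal (gammaKernel x k n / (k : ℕ)) := by
          rw [ENNReal.tsum_comm]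
          refine tsum_congr fun n => tsum_congr fun k => ?_
          have hn := sub_pos_of_mem_Ioi hx1 n
          rw [← ENNReal.ofReal_mul (by positivity), ← ENNReal.ofReal_mul (by positivity)]
          congr 1
          ring
      _ = _ := tsum_congr fun n => by
          have hn := sub_pos_of_mem_Ioi hx1 n
          rw [ENNReal.tsum_mul_left, tsum_gammaKernel_left hx (pos_of_mem_Ioi n),
            ← ENNReal.ofReal_mul (by positivity), gammaKernel_eq_mul hx1 m n]
          congr 1
          field_simp
  -- The factor `1/m` opens `betaKernel x m n` into a sum over `n' > n`; the factor `1/(m-x)` then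
  -- lets the sum over `m` telescope to `1/n'`.
  calc _ = ∑' m : Set.Ioi 0, ∑' n : Set.Ioi 0, ENNReal.ofReal (1 / ((n : ℕ) - x) ^ 2) *
          ∑' n' : Set.Ioi (n : ℕ), ENNReal.ofReal (1 / ((n' : ℕ) - x)) *
            ENNReal.ofReal (betaKernel x m n' / ((m : ℕ) - x)) := tsum_congr fun m => by
        rw [key, ← ENNReal.tsum_mul_left]
        refine tsum_congr fun n => ?_
        have hm := sub_pos_of_mem_Ioi hx1 m
        have hm0 : (0 : ℝ) < (m : ℕ) := by exact_mod_cast pos_of_mem_Ioi m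
        have hn := sub_pos_of_mem_Ioi hx1 n
        have h : ∀ n' : Set.Ioi (n : ℕ), ENNReal.ofReal (1 / ((n' : ℕ) - x)) *
            ENNReal.ofReal (betaKernel x m n' / ((m : ℕ) - x)) =
            ENNReal.ofReal (1 / ((m : ℕ) - x)) *
              ENNReal.ofReal (betaKernel x m n' / ((n' : ℕ) - x)) := fun n' => by
          have hn' := sub_pos_of_mem_Ioi hx1 n'
          rw [← ENNReal.ofReal_mul (by positivity), ← ENNReal.ofReal_mul (by positivity)]
          congr 1
          ring
        rw [tsum_congr h, ENNReal.tsum_mul_left, tsum_betaKernel_right hx1 (pos_of_mem_Ioi m),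
          ← ENNReal.ofReal_mul (by positivity), ← ENNReal.ofReal_mul (by positivity),
          ← ENNReal.ofReal_mul (by positivity)]
        congr 1
        field_simp
    _ = ∑' n : Set.Ioi 0, ENNReal.ofReal (1 / ((n : ℕ) - x) ^ 2) *
          ∑' n' : Set.Ioi (n : ℕ), ENNReal.ofReal (1 / ((n' : ℕ) - x)) *
            ∑' m : Set.Ioi 0, ENNReal.ofReal (betaKernel x m n' / ((m : ℕ) - x)) := by
        rw [ENNReal.tsum_comm]
        refine tsum_congr fun n => ?_
        rw [ENNReal.tsum_mul_left, ENNReal.tsum_comm]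
        simp only [ENNReal.tsum_mul_left]
    _ = _ := tsum_congr fun n => by
        congr 1
        refine tsum_congr fun n' => ?_
        rw [tsum_betaKernel_left hx0 hx (pos_of_mem_Ioi n'), betaKernel_zero_left,
          ← ENNReal.ofReal_mul (one_div_nonneg.2 (sub_pos_of_mem_Ioi hx1 n').le)]
        congr 1
        rw [div_mul_div_comm, one_mul, mul_comm (((n' : ℕ) : ℝ) - x)]

end Kernels

/-! ### Nested sums in `ENNReal`, split at the first or last index -/

theorem ENNReal.tsum_pi_snoc {r : ℕ} (f : (Fin (r + 1) → ℕ) → ENNReal) :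
    ∑' k, f k = ∑' (l : ℕ) (k : Fin r → ℕ), f (Fin.snoc k l) := by
  rw [← (Fin.snocEquiv fun _ : Fin (r + 1) => ℕ).tsum_eq, ENNReal.tsum_prod']
  rfl

theorem ENNReal.tsum_pi_cons {r : ℕ} (f : (Fin (r + 1) → ℕ) → ENNReal) :
    ∑' k, f k = ∑' (l : ℕ) (k : Fin r → ℕ), f (Fin.cons l k) := by
  rw [← (Fin.consEquiv fun _ : Fin (r + 1) => ℕ).tsum_eq, ENNReal.tsum_prod']
  rfl

/-- The strictly increasing `r`-tuples of elements of `I`. -/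
def incTuples (r : ℕ) (I : Set ℕ) : Set (Fin r → ℕ) := {k | StrictMono k ∧ ∀ i, k i ∈ I}

/-- The sum of `k₁ ^ (-α₁) ⋯ k_r ^ (-α_r)` over the strictly increasing tuples of elements
of `I`. -/
noncomputable def nestedSum {r : ℕ} (I : Set ℕ) (α : Fin r → ℕ) : ENNReal :=
  ∑' k : incTuples r I, ∏ i, ((k.1 i : ENNReal) ^ α i)⁻¹

theorem strictMono_snoc_iff {r : ℕ} (k : Fin r → ℕ) (l : ℕ) :
    StrictMono (Fin.snoc k l : Fin (r + 1) → ℕ) ↔ StrictMono k ∧ ∀ i, k i < l := by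
  constructor
  · refine fun h => ⟨fun i j hij => ?_, fun i => ?_⟩
    · simpa using h (Fin.castSucc_lt_castSucc_iff.2 hij)
    · simpa using h (Fin.castSucc_lt_last i)
  · rintro ⟨h, h'⟩ i j hij
    induction j using Fin.lastCases with
    | last =>
      induction i using Fin.lastCases with
      | last => exact absurd hij (lt_irrefl _)
      | cast i => simpa using h' i
    | cast j =>
      induction i using Fin.lastCases with
      | last => exact absurd (hij.trans (Fin.castSucc_lt_last j)) (lt_irrefl _)
      | cast i => simpa using h (Fin.castSucc_lt_castSucc_iff.1 hij)

theorem strictMono_cons_iff {r : ℕ} (k : Fin r → ℕ) (l : ℕ) :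
    StrictMono (Fin.cons l k : Fin (r + 1) → ℕ) ↔ StrictMono k ∧ ∀ i, l < k i := by
  constructor
  · refine fun h => ⟨fun i j hij => ?_, fun i => ?_⟩
    · simpa using h (Fin.succ_lt_succ_iff.2 hij)
    · simpa using h (Fin.succ_pos i)
  · rintro ⟨h, h'⟩ i j hij
    induction j using Fin.cases with
    | zero => exact absurd hij (Fin.not_lt_zero i)
    | succ j =>
      induction i using Fin.cases with
      | zero => simpa using h' j
      | succ i => simpa using h (Fin.succ_lt_succ_iff.1 hij)

theorem snoc_mem_incTuples {r : ℕ} {I : Set ℕ} (k : Fin r → ℕ) (l : ℕ) :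
    (Fin.snoc k l : Fin (r + 1) → ℕ) ∈ incTuples (r + 1) I ↔
      l ∈ I ∧ k ∈ incTuples r (I ∩ Set.Iio l) := by
  simp only [incTuples, Set.mem_ofPred_eq, strictMono_snoc_iff, Fin.forall_fin_succ',
    Fin.snoc_castSucc, Fin.snoc_last, Set.mem_inter_iff, Set.mem_Iio, forall_and]
  tauto

theorem cons_mem_incTuples {r : ℕ} {I : Set ℕ} (k : Fin r → ℕ) (l : ℕ) :
    (Fin.cons l k : Fin (r + 1) → ℕ) ∈ incTuples (r + 1) I ↔
      l ∈ I ∧ k ∈ incTuples r (I ∩ Set.Ioi l) := by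
  simp only [incTuples, Set.mem_ofPred_eq, strictMono_cons_iff, Fin.forall_fin_succ,
    Fin.cons_succ, Fin.cons_zero, Set.mem_inter_iff, Set.mem_Ioi, forall_and]
  tauto

theorem nestedSum_snoc {r : ℕ} (I : Set ℕ) (α : Fin r → ℕ) (s : ℕ) :
    nestedSum I (Fin.snoc α s : Fin (r + 1) → ℕ) =
      ∑' l : I, nestedSum (I ∩ Set.Iio (l : ℕ)) α * (((l : ℕ) : ENNReal) ^ s)⁻¹ := by
  classical
  rw [nestedSum, tsum_subtype (incTuples (r + 1) I)
    (fun k => ∏ i, ((k i : ENNReal) ^ (Fin.snoc α s : Fin (r + 1) → ℕ) i)⁻¹),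
    ENNReal.tsum_pi_snoc,
    tsum_subtype I (fun l => nestedSum (I ∩ Set.Iio l) α * ((l : ENNReal) ^ s)⁻¹)]
  refine tsum_congr fun l => ?_
  by_cases hl : l ∈ I
  · rw [Set.indicator_of_mem hl, nestedSum, tsum_subtype (incTuples r (I ∩ Set.Iio l))
      (fun k => ∏ i, ((k i : ENNReal) ^ α i)⁻¹), ← ENNReal.tsum_mul_right]
    refine tsum_congr fun k => ?_
    simp only [Set.indicator_apply, snoc_mem_incTuples, hl, true_and, Fin.prod_univ_castSucc,
      Fin.snoc_castSucc, Fin.snoc_last, ite_mul, zero_mul]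
  · simp [hl, snoc_mem_incTuples]

theorem nestedSum_cons {r : ℕ} (I : Set ℕ) (α : Fin r → ℕ) (s : ℕ) :
    nestedSum I (Fin.cons s α : Fin (r + 1) → ℕ) =
      ∑' l : I, (((l : ℕ) : ENNReal) ^ s)⁻¹ * nestedSum (I ∩ Set.Ioi (l : ℕ)) α := by
  classical
  rw [nestedSum, tsum_subtype (incTuples (r + 1) I)
    (fun k => ∏ i, ((k i : ENNReal) ^ (Fin.cons s α : Fin (r + 1) → ℕ) i)⁻¹),
    ENNReal.tsum_pi_cons,
    tsum_subtype I (fun l => ((l : ENNReal) ^ s)⁻¹ * nestedSum (I ∩ Set.Ioi l) α)]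
  refine tsum_congr fun l => ?_
  by_cases hl : l ∈ I
  · rw [Set.indicator_of_mem hl, nestedSum, tsum_subtype (incTuples r (I ∩ Set.Ioi l))
      (fun k => ∏ i, ((k i : ENNReal) ^ α i)⁻¹), ← ENNReal.tsum_mul_left]
    refine tsum_congr fun k => ?_
    simp only [Set.indicator_apply, cons_mem_incTuples, hl, true_and, Fin.prod_univ_succ,
      Fin.cons_succ, Fin.cons_zero, mul_ite, mul_zero]
  · simp [hl, cons_mem_incTuples]

theorem nestedSum_fin_zero (I : Set ℕ) (α : Fin 0 → ℕ) : nestedSum I α = 1 := by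
  have h : incTuples 0 I = Set.univ :=
    Set.eq_univ_of_forall fun k => ⟨Subsingleton.strictMono k, fun i => i.elim0⟩
  rw [nestedSum, h, tsum_univ (fun k : Fin 0 → ℕ => ∏ i, ((k i : ENNReal) ^ α i)⁻¹)]
  simp

theorem nestedSum_singleton (I : Set ℕ) (s : ℕ) :
    nestedSum I ![s] = ∑' l : I, (((l : ℕ) : ENNReal) ^ s)⁻¹ := by
  have h : (![s] : Fin 1 → ℕ) = Fin.snoc (fun i : Fin 0 => i.elim0) s := by
    ext i
    rw [Subsingleton.elim i (Fin.last 0), Fin.snoc_last]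
    rfl
  rw [h, nestedSum_snoc]
  simp only [nestedSum_fin_zero, one_mul]

theorem multiZeta_nonneg {r : ℕ} (α : Fin r → ℕ) : 0 ≤ multiZeta α :=
  tsum_nonneg fun _ => Finset.prod_nonneg fun _ _ => by positivity

theorem ofReal_multiZeta {r : ℕ} {α : Fin (r + 1) → ℕ} (h1 : ∀ i, 1 ≤ α i)
    (h2 : 2 ≤ α (Fin.last r)) :
    ENNReal.ofReal (multiZeta α) = nestedSum (Set.Ioi 0) α := by
  rw [multiZeta, ENNReal.ofReal_tsum_of_nonneg
    (fun _ => Finset.prod_nonneg fun _ _ => by positivity) (summable_multiZeta α h1 h2)]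
  let e : IncTuple (r + 1) ≃ incTuples (r + 1) (Set.Ioi 0) :=
    Equiv.subtypeEquivRight fun k => and_comm
  rw [nestedSum, ← e.tsum_eq]
  refine tsum_congr fun k => ?_
  rw [ENNReal.ofReal_prod_of_nonneg fun _ _ => by positivity]
  refine Finset.prod_congr rfl fun i _ => ?_
  have hk : (0 : ℝ) < k.1 i := by exact_mod_cast k.2.1 i
  rw [ENNReal.ofReal_inv_of_pos (by positivity), ENNReal.ofReal_pow hk.le, ENNReal.ofReal_natCast]
  rfl

/-! ### Generating functions over all depths and weights -/

section Generating

variable (y : ENNReal)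

/-- The generating function of the nested sums over `I` of all depths and weights. -/
noncomputable def nestedGen (I : Set ℕ) : ENNReal :=
  ∑' (a : ℕ) (β : Fin a → ℕ), y ^ (a + ∑ i, β i) * nestedSum I (fun i => β i + 1)

/-- Fixing the largest index `k` decouples its exponent from everything below `k`. The shift `e = 1`
yields the recursion for `nestedGen`; `e = 2` handles a bumped last entry. -/
theorem tsum_nestedSum_snoc (I : Set ℕ) (e : ℕ) :
    ∑' (a : ℕ) (β : Fin a → ℕ) (s : ℕ), y ^ (a + ∑ i, β i + s) *
        nestedSum I (Fin.snoc (fun i => β i + 1) (s + e) : Fin (a + 1) → ℕ) =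
      ∑' k : I, nestedGen y (I ∩ Set.Iio (k : ℕ)) *
        ∑' s : ℕ, y ^ s * (((k : ℕ) : ENNReal) ^ (s + e))⁻¹ := by
  calc _ = ∑' (a : ℕ) (β : Fin a → ℕ) (k : I), (y ^ (a + ∑ i, β i) *
        nestedSum (I ∩ Set.Iio (k : ℕ)) (fun i => β i + 1)) *
        ∑' s : ℕ, y ^ s * (((k : ℕ) : ENNReal) ^ (s + e))⁻¹ := by
        refine tsum_congr fun a => tsum_congr fun β => ?_
        simp only [nestedSum_snoc, ← ENNReal.tsum_mul_left]
        rw [ENNReal.tsum_comm]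
        refine tsum_congr fun k => tsum_congr fun s => ?_
        rw [pow_add]
        ring
    _ = ∑' (a : ℕ) (k : I) (β : Fin a → ℕ), (y ^ (a + ∑ i, β i) *
        nestedSum (I ∩ Set.Iio (k : ℕ)) (fun i => β i + 1)) *
        ∑' s : ℕ, y ^ s * (((k : ℕ) : ENNReal) ^ (s + e))⁻¹ :=
        tsum_congr fun a => ENNReal.tsum_comm
    _ = _ := by
        rw [ENNReal.tsum_comm]
        simp only [ENNReal.tsum_mul_right, nestedGen]

theorem nestedGen_eq_one_add (I : Set ℕ) :
    nestedGen y I = 1 + ∑' k : I, nestedGen y (I ∩ Set.Iio (k : ℕ)) *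
      (y * ∑' s : ℕ, y ^ s * (((k : ℕ) : ENNReal) ^ (s + 1))⁻¹) := by
  have h : ∀ J : Set ℕ, ∀ z : ENNReal, nestedGen y J * (y * z) = y * (nestedGen y J * z) :=
    fun J z => mul_left_comm _ _ _
  simp only [h]
  rw [ENNReal.tsum_mul_left, ← tsum_nestedSum_snoc, nestedGen,
    tsum_eq_zero_add' ENNReal.summable]
  congr 1
  · rw [tsum_fintype]
    simp [nestedSum_fin_zero]
  · simp only [← ENNReal.tsum_mul_left]
    refine tsum_congr fun a => ?_
    rw [ENNReal.tsum_pi_snoc, ENNReal.tsum_comm]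
    refine tsum_congr fun β => tsum_congr fun s => ?_
    rw [← mul_assoc, ← pow_succ', Fin.sum_univ_castSucc]
    simp only [Fin.snoc_castSucc, Fin.snoc_last]
    congr 2
    · ring
    · exact Fin.comp_snoc (α := ℕ) (fun n => n + 1) β s

theorem sum_posTuples {M : Type*} [AddCommMonoid M] (r b : ℕ) (g : (Fin r → ℕ) → M) :
    ∑ α ∈ posTuples r (r + b), g α =
      ∑ β ∈ Finset.Nat.antidiagonalTuple r b, g (fun i => β i + 1) := by
  refine Finset.sum_nbij' (fun α i => α i - 1) (fun β i => β i + 1) (fun α h => ?_)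
    (fun β h => ?_) (fun α h => ?_) (fun β h => ?_) (fun α h => ?_)
  · rw [mem_posTuples] at h
    rw [Finset.Nat.mem_antidiagonalTuple]
    have h' : ∑ i, α i = ∑ i, ((α i - 1) + 1) :=
      Finset.sum_congr rfl fun i _ => (Nat.sub_add_cancel (h.2 i)).symm
    rw [h.1, Finset.sum_add_distrib] at h'
    simp only [Finset.sum_const, Finset.card_univ, Fintype.card_fin, smul_eq_mul, mul_one] at h'
    omega
  · rw [Finset.Nat.mem_antidiagonalTuple] at h
    rw [mem_posTuples]
    refine ⟨?_, fun i => Nat.le_add_left _ _⟩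
    rw [Finset.sum_add_distrib, h]
    simp [add_comm]
  · rw [mem_posTuples] at h
    funext i
    exact Nat.sub_add_cancel (h.2 i)
  · funext i
    exact Nat.add_sub_cancel _ _
  · rw [mem_posTuples] at h
    congr 1
    funext i
    exact (Nat.sub_add_cancel (h.2 i)).symm

theorem ENNReal.tsum_sum_antidiagonalTuple (r : ℕ) (f : (Fin r → ℕ) → ENNReal) :
    ∑' p : ℕ, ∑ t ∈ Finset.Nat.antidiagonalTuple r p, f t = ∑' t, f t := by
  rw [← (Finset.Nat.sigmaAntidiagonalTupleEquivTuple r).tsum_eq, ENNReal.tsum_sigma']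
  refine tsum_congr fun p => ?_
  rw [← Finset.tsum_subtype]
  rfl

theorem bumpLast_snoc {a : ℕ} (α : Fin a → ℕ) (s : ℕ) :
    bumpLast (Fin.snoc α s : Fin (a + 1) → ℕ) = Fin.snoc α (s + 1) := by
  rw [bumpLast, Fin.snoc_last, Fin.update_snoc_last]

/-- Subtracting 1 from each of the `a + 1` entries leaves total excess `b`, so summing over `b`
removes the weight constraint. The `+ 2` is one for positivity and one for the bump. -/
theorem tsum_sum_posTuples_bumpLast (a : ℕ) (h : (Fin (a + 1) → ℕ) → ENNReal) :
    ∑' b : ℕ, y ^ b * ∑ α ∈ posTuples (a + 1) (a + b + 1), h (bumpLast α) =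
      ∑' (β : Fin a → ℕ) (s : ℕ), y ^ (∑ i, β i + s) *
        h (Fin.snoc (fun i => β i + 1) (s + 2) : Fin (a + 1) → ℕ) := by
  calc _ = ∑' b : ℕ, ∑ β ∈ Finset.Nat.antidiagonalTuple (a + 1) b,
        y ^ (∑ i, β i) * h (bumpLast fun i => β i + 1) := tsum_congr fun b => by
        rw [show a + b + 1 = a + 1 + b by ring, sum_posTuples, Finset.mul_sum]
        refine Finset.sum_congr rfl fun β hβ => ?_
        rw [(Finset.Nat.mem_antidiagonalTuple.1 hβ)]
    _ = _ := by
        rw [ENNReal.tsum_sum_antidiagonalTuple, ENNReal.tsum_pi_snoc, ENNReal.tsum_comm]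
        refine tsum_congr fun β => tsum_congr fun s => ?_
        rw [Fin.sum_univ_castSucc]
        simp only [Fin.snoc_castSucc, Fin.snoc_last]
        congr 2
        rw [show (fun i => (Fin.snoc β s : Fin (a + 1) → ℕ) i + 1) =
          (Fin.snoc (fun i => β i + 1) (s + 1) : Fin (a + 1) → ℕ) from
          Fin.comp_snoc (α := ℕ) (fun n => n + 1) β s, bumpLast_snoc]

theorem tsum_antidiagonalTuple_three (H : ℕ → ℕ → ℕ → ENNReal) :
    ∑' p : ℕ, y ^ p * ∑ t ∈ Finset.Nat.antidiagonalTuple 3 p, H (t 0) (t 1) (t 2) =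
      ∑' (a : ℕ) (b : ℕ) (c : ℕ), y ^ (a + b + c) * H a b c := by
  calc _ = ∑' p : ℕ, ∑ t ∈ Finset.Nat.antidiagonalTuple 3 p,
        y ^ (t 0 + t 1 + t 2) * H (t 0) (t 1) (t 2) := tsum_congr fun p => by
        rw [Finset.mul_sum]
        refine Finset.sum_congr rfl fun t ht => ?_
        rw [← Finset.Nat.mem_antidiagonalTuple.1 ht, Fin.sum_univ_three]
    _ = _ := by
        rw [ENNReal.tsum_sum_antidiagonalTuple, ENNReal.tsum_pi_cons]
        refine tsum_congr fun a => ?_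
        rw [ENNReal.tsum_pi_cons]
        refine tsum_congr fun b => ?_
        rw [ENNReal.tsum_pi_cons]
        refine tsum_congr fun c => ?_
        rw [tsum_fintype, Fintype.sum_unique]
        rfl

theorem tsum_tsum_Ioo_comm (f : ℕ → ℕ → ENNReal) (m : ℕ) :
    ∑' (l : Set.Ioi m) (k : Set.Ioo m (l : ℕ)), f k l =
      ∑' (k : Set.Ioi m) (l : Set.Ioi (k : ℕ)), f k l := by
  classical
  rw [tsum_subtype (Set.Ioi m) (fun l => ∑' k : Set.Ioo m l, f k l),
    tsum_subtype (Set.Ioi m) (fun k => ∑' l : Set.Ioi k, f k l)]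
  have h1 : ∀ l, (Set.Ioi m).indicator (fun l => ∑' k : Set.Ioo m l, f k l) l =
      ∑' k, if m < k ∧ k < l then f k l else 0 := fun l => by
    simp only [tsum_subtype (Set.Ioo m l) (fun k => f k l), Set.indicator_apply, Set.mem_Ioi,
      Set.mem_Ioo]
    split_ifs with h
    · rfl
    · symm
      rw [ENNReal.tsum_eq_zero]
      intro k
      rw [if_neg (by omega)]
  have h2 : ∀ k, (Set.Ioi m).indicator (fun k => ∑' l : Set.Ioi k, f k l) k =
      ∑' l, if m < k ∧ k < l then f k l else 0 := fun k => by
    simp only [tsum_subtype (Set.Ioi k) (fun l => f k l), Set.indicator_apply, Set.mem_Ioi]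
    split_ifs with h <;> simp [h]
  rw [tsum_congr h1, tsum_congr h2, ENNReal.tsum_comm]

theorem tsum_nestedSum_snoc_bumpLast :
    ∑' p : ℕ, y ^ p * ∑ t ∈ Finset.Nat.antidiagonalTuple 3 p,
        ∑ α ∈ posTuples (t 0 + 1) (t 0 + t 1 + 1), nestedSum (Set.Ioi 0)
          (Fin.snoc (bumpLast α) (t 2 + 2) : Fin (t 0 + 1 + 1) → ℕ) =
      ∑' k : Set.Ioi 0, (nestedGen y (Set.Ioo 0 (k : ℕ)) *
        ∑' s : ℕ, y ^ s * (((k : ℕ) : ENNReal) ^ (s + 2))⁻¹) *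
        ∑' l : Set.Ioi (k : ℕ), ∑' c : ℕ, y ^ c * (((l : ℕ) : ENNReal) ^ (c + 2))⁻¹ := by
  rw [tsum_antidiagonalTuple_three y (fun a b c => ∑ α ∈ posTuples (a + 1) (a + b + 1),
    nestedSum (Set.Ioi 0) (Fin.snoc (bumpLast α) (c + 2) : Fin (a + 1 + 1) → ℕ))]
  calc _ = ∑' (a : ℕ) (c : ℕ), y ^ (a + c) * ∑' (b : ℕ), y ^ b *
          ∑ α ∈ posTuples (a + 1) (a + b + 1),
          nestedSum (Set.Ioi 0) (Fin.snoc (bumpLast α) (c + 2) : Fin (a + 1 + 1) → ℕ) := by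
        refine tsum_congr fun a => ?_
        rw [ENNReal.tsum_comm]
        simp only [← ENNReal.tsum_mul_left]
        refine tsum_congr fun c => tsum_congr fun b => ?_
        ring
    _ = ∑' (c : ℕ) (a : ℕ), y ^ (a + c) * ∑' (β : Fin a → ℕ) (s : ℕ), y ^ (∑ i, β i + s) *
          nestedSum (Set.Ioi 0) (Fin.snoc (Fin.snoc (fun i => β i + 1) (s + 2) : Fin (a + 1) → ℕ)
            (c + 2) : Fin (a + 1 + 1) → ℕ) := by
        rw [ENNReal.tsum_comm]
        refine tsum_congr fun c => tsum_congr fun a => ?_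
        rw [tsum_sum_posTuples_bumpLast y a (fun α => nestedSum (Set.Ioi 0)
          (Fin.snoc α (c + 2) : Fin (a + 1 + 1) → ℕ))]
    _ = ∑' (c : ℕ) (l : Set.Ioi 0), y ^ c * (((l : ℕ) : ENNReal) ^ (c + 2))⁻¹ *
          ∑' (a : ℕ) (β : Fin a → ℕ) (s : ℕ), y ^ (a + ∑ i, β i + s) *
          nestedSum (Set.Ioi 0 ∩ Set.Iio (l : ℕ))
            (Fin.snoc (fun i => β i + 1) (s + 2) : Fin (a + 1) → ℕ) := by
        refine tsum_congr fun c => ?_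
        simp only [nestedSum_snoc (Set.Ioi 0), ← ENNReal.tsum_mul_left]
        -- The sum over the largest index `l` is moved outwards past `s`, `β` and `a` in turn.
        refine Eq.trans (tsum_congr fun a => ?_) ENNReal.tsum_comm
        refine Eq.trans (tsum_congr fun β => ?_) ENNReal.tsum_comm
        refine Eq.trans (tsum_congr fun s => tsum_congr fun l => ?_) ENNReal.tsum_comm
        rw [pow_add, pow_add, pow_add, pow_add]
        ring
    _ = ∑' (l : Set.Ioi 0) (k : Set.Ioo 0 (l : ℕ)), nestedGen y (Set.Ioo 0 (k : ℕ)) *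
          (∑' s : ℕ, y ^ s * (((k : ℕ) : ENNReal) ^ (s + 2))⁻¹) *
          (∑' c : ℕ, y ^ c * (((l : ℕ) : ENNReal) ^ (c + 2))⁻¹) := by
        rw [ENNReal.tsum_comm]
        refine tsum_congr fun l => ?_
        rw [ENNReal.tsum_mul_right, tsum_nestedSum_snoc, Set.Ioi_inter_Iio, mul_comm,
          ENNReal.tsum_mul_right]
        congr 1
        refine tsum_congr fun k => ?_
        rw [Set.Ioo_inter_Iio, min_eq_right k.2.2.le]
    _ = _ := by
        rw [tsum_tsum_Ioo_comm fun k l => nestedGen y (Set.Ioo 0 k) *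
          (∑' s : ℕ, y ^ s * ((k : ENNReal) ^ (s + 2))⁻¹) *
          (∑' c : ℕ, y ^ c * ((l : ENNReal) ^ (c + 2))⁻¹)]
        simp only [ENNReal.tsum_mul_left]

theorem tsum_nestedSum_cons_bumpLast :
    ∑' p : ℕ, y ^ p * ∑ t ∈ Finset.Nat.antidiagonalTuple 3 p,
        ∑ β ∈ posTuples (t 1 + 1) (t 1 + t 2 + 1), nestedSum (Set.Ioi 0)
          (Fin.cons (t 0 + 2) (bumpLast β) : Fin (t 1 + 1 + 1) → ℕ) =
      ∑' m : Set.Ioi 0, (∑' c : ℕ, y ^ c * (((m : ℕ) : ENNReal) ^ (c + 2))⁻¹) *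
        ∑' k : Set.Ioi (m : ℕ), nestedGen y (Set.Ioo (m : ℕ) (k : ℕ)) *
          ∑' s : ℕ, y ^ s * (((k : ℕ) : ENNReal) ^ (s + 2))⁻¹ := by
  rw [tsum_antidiagonalTuple_three y (fun a b c => ∑ α ∈ posTuples (b + 1) (b + c + 1),
    nestedSum (Set.Ioi 0) (Fin.cons (a + 2) (bumpLast α) : Fin (b + 1 + 1) → ℕ))]
  calc _ = ∑' (a : ℕ) (b : ℕ), y ^ (a + b) * ∑' (c : ℕ), y ^ c *
          ∑ α ∈ posTuples (b + 1) (b + c + 1),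
          nestedSum (Set.Ioi 0) (Fin.cons (a + 2) (bumpLast α) : Fin (b + 1 + 1) → ℕ) := by
        refine tsum_congr fun a => tsum_congr fun b => ?_
        simp only [← ENNReal.tsum_mul_left]
        refine tsum_congr fun c => ?_
        ring
    _ = ∑' (a : ℕ) (b : ℕ), y ^ (a + b) * ∑' (β : Fin b → ℕ) (s : ℕ), y ^ (∑ i, β i + s) *
          nestedSum (Set.Ioi 0) (Fin.cons (a + 2)
            (Fin.snoc (fun i => β i + 1) (s + 2) : Fin (b + 1) → ℕ) : Fin (b + 1 + 1) → ℕ) := by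
        refine tsum_congr fun a => tsum_congr fun b => ?_
        rw [tsum_sum_posTuples_bumpLast y b (fun α => nestedSum (Set.Ioi 0)
          (Fin.cons (a + 2) α : Fin (b + 1 + 1) → ℕ))]
    _ = ∑' (a : ℕ) (m : Set.Ioi 0), y ^ a * (((m : ℕ) : ENNReal) ^ (a + 2))⁻¹ *
          ∑' (b : ℕ) (β : Fin b → ℕ) (s : ℕ), y ^ (b + ∑ i, β i + s) *
          nestedSum (Set.Ioi 0 ∩ Set.Ioi (m : ℕ))
            (Fin.snoc (fun i => β i + 1) (s + 2) : Fin (b + 1) → ℕ) := by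
        refine tsum_congr fun a => ?_
        simp only [nestedSum_cons (Set.Ioi 0), ← ENNReal.tsum_mul_left]
        refine Eq.trans (tsum_congr fun b => ?_) ENNReal.tsum_comm
        refine Eq.trans (tsum_congr fun β => ?_) ENNReal.tsum_comm
        refine Eq.trans (tsum_congr fun s => tsum_congr fun l => ?_) ENNReal.tsum_comm
        rw [pow_add, pow_add, pow_add, pow_add]
        ring
    _ = _ := by
        rw [ENNReal.tsum_comm]
        refine tsum_congr fun m => ?_
        rw [ENNReal.tsum_mul_right, tsum_nestedSum_snoc, Set.Ioi_inter_Ioi,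
          sup_eq_right.2 (Nat.zero_le _)]
        congr 1

end Generating

/-! ### Identity theorem for power series on `(0, r]` -/

theorem eq_zero_of_tsum_pow_mul_eq_zero {c : ℕ → ℝ} {r : ℝ} (hr : 0 < r)
    (hs : Summable fun p => r ^ p * |c p|)
    (h : ∀ x, 0 < x → x ≤ r → ∑' p, x ^ p * c p = 0) (q : ℕ) : c q = 0 := by
  have hs' : ∀ n, Summable fun i => r ^ i * |c (i + n)| := fun n => by
    refine (((summable_nat_add_iff n).2 hs).mul_left (r ^ n)⁻¹).congr fun i => ?_
    rw [pow_add r i n]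
    field_simp
  induction q using Nat.strong_induction_on with
  | _ q ih =>
  -- The earlier coefficients vanish, so dividing the series by `x ^ q` leaves `c q` plus a tail of
  -- size `O(x)`; then `x → 0⁺`.
  have bound : ∀ x, 0 < x → x ≤ r → |c q| ≤ x * ∑' i, r ^ i * |c (i + (q + 1))| := by
    intro x hx hxr
    have h0 := h x hx hxr
    have hsx : Summable fun p => x ^ p * c p := by
      refine Summable.of_norm_bounded hs fun i => ?_
      rw [norm_mul, norm_pow, Real.norm_of_nonneg hx.le, Real.norm_eq_abs]
      gcongr
    rw [← hsx.sum_add_tsum_nat_add (q + 1), Finset.sum_range_succ,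
      Finset.sum_eq_zero fun i hi => by rw [ih i (Finset.mem_range.1 hi), mul_zero]] at h0
    have h1 : ∑' i, x ^ (i + (q + 1)) * c (i + (q + 1)) =
        x ^ q * (x * ∑' i, x ^ i * c (i + (q + 1))) := by
      rw [← tsum_mul_left, ← tsum_mul_left]
      exact tsum_congr fun i => by ring
    rw [h1, zero_add, ← mul_add] at h0
    have h2 : c q = -(x * ∑' i, x ^ i * c (i + (q + 1))) := by
      have := (mul_eq_zero.1 h0).resolve_left (pow_pos hx q).ne'
      linarith
    rw [h2, abs_neg, abs_mul, abs_of_pos hx]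
    refine mul_le_mul_of_nonneg_left ?_ hx.le
    rw [← Real.norm_eq_abs]
    refine tsum_of_norm_bounded (hs' _).hasSum fun i => ?_
    rw [norm_mul, norm_pow, Real.norm_of_nonneg hx.le, Real.norm_eq_abs]
    gcongr
  have hlim : Tendsto (fun x : ℝ => x * ∑' i, r ^ i * |c (i + (q + 1))|) (𝓝[>] 0) (𝓝 0) := by
    refine Tendsto.mono_left ?_ nhdsWithin_le_nhds
    have := (continuous_mul_const (∑' i, r ^ i * |c (i + (q + 1))|)).tendsto (0 : ℝ)
    rwa [zero_mul] at this
  have hle : |c q| ≤ 0 := by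
    refine ge_of_tendsto hlim ?_
    filter_upwards [Ioc_mem_nhdsGT hr] with x hx using bound x hx.1 hx.2
  exact abs_nonpos_iff.1 hle

/-- Two power series with nonnegative coefficients which agree on `(0, r]` coincide. -/
theorem eq_of_tsum_ofReal_pow_mul_eq {a b : ℕ → ℝ} (ha : ∀ p, 0 ≤ a p) (hb : ∀ p, 0 ≤ b p)
    {r : ℝ} (hr : 0 < r)
    (h : ∀ x, 0 < x → x ≤ r → ∑' p, ENNReal.ofReal x ^ p * ENNReal.ofReal (a p) =
      ∑' p, ENNReal.ofReal x ^ p * ENNReal.ofReal (b p))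
    (hfin : ∑' p, ENNReal.ofReal r ^ p * ENNReal.ofReal (b p) ≠ ⊤) : a = b := by
  have conv : ∀ f : ℕ → ℝ, (∀ p, 0 ≤ f p) → ∀ x, 0 < x →
      ∀ p, (ENNReal.ofReal x ^ p * ENNReal.ofReal (f p)).toReal = x ^ p * f p :=
    fun f hf x hx p => by
      rw [ENNReal.toReal_mul, ENNReal.toReal_pow, ENNReal.toReal_ofReal hx.le,
        ENNReal.toReal_ofReal (hf p)]
  have mono : ∀ f : ℕ → ℝ, (∀ p, 0 ≤ f p) → Summable (fun p => r ^ p * f p) →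
      ∀ x, 0 < x → x ≤ r → Summable (fun p => x ^ p * f p) := fun f hf hs x hx hxr =>
    Summable.of_nonneg_of_le (fun p => mul_nonneg (by positivity) (hf p))
      (fun p => mul_le_mul_of_nonneg_right (pow_le_pow_left₀ hx.le hxr p) (hf p)) hs
  have hsb : Summable fun p => r ^ p * b p :=
    (ENNReal.summable_toReal hfin).congr (conv b hb r hr)
  have hsa : Summable fun p => r ^ p * a p :=
    (ENNReal.summable_toReal ((h r hr le_rfl).trans_ne hfin)).congr (conv a ha r hr)
  funext q
  refine sub_eq_zero.1 (eq_zero_of_tsum_pow_mul_eq_zero (c := fun p => a p - b p) hr ?_ ?_ q)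
  · refine Summable.of_nonneg_of_le (fun p => by positivity) (fun p => ?_) (hsa.add hsb)
    rw [← mul_add]
    gcongr
    exact (abs_sub _ _).trans_eq (by rw [abs_of_nonneg (ha p), abs_of_nonneg (hb p)])
  · intro x hx hxr
    have h' := congrArg ENNReal.toReal (h x hx hxr)
    rw [ENNReal.tsum_toReal_eq fun p => ENNReal.mul_ne_top (by finiteness) (by finiteness),
      ENNReal.tsum_toReal_eq fun p => ENNReal.mul_ne_top (by finiteness) (by finiteness),
      tsum_congr (conv a ha x hx), tsum_congr (conv b hb x hx)] at h'
    simp only [mul_sub]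
    rw [(mono a ha hsa x hx hxr).tsum_sub (mono b hb hsb x hx hxr), h', sub_self]

/-! ### Evaluation of the generating functions at real `x` -/

section

variable {x : ℝ}

theorem tsum_choose_mul_pow_mul_inv_pow (hx0 : 0 ≤ x) (hx : x < 1) {l : ℕ} (hl : 0 < l)
    (j e : ℕ) :
    ∑' s : ℕ, ENNReal.ofReal x ^ s * (((s + j).choose j : ENNReal) * ((l : ENNReal) ^ (s + e))⁻¹) =
      ENNReal.ofReal (1 / (l : ℝ) ^ e * (1 / (1 - x / l) ^ (j + 1))) := by
  have hl' : (1 : ℝ) ≤ l := by exact_mod_cast hl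
  have hl0 : (0 : ℝ) < l := by linarith
  have hnorm : ‖x / l‖ < 1 := by
    rw [Real.norm_of_nonneg (by positivity), div_lt_one hl0]
    linarith
  have h := (hasSum_choose_mul_geometric_of_norm_lt_one j hnorm).mul_left (1 / (l : ℝ) ^ e)
  rw [← h.tsum_eq, ENNReal.ofReal_tsum_of_nonneg (fun s => by positivity) h.summable]
  refine tsum_congr fun s => ?_
  rw [← ENNReal.ofReal_pow hx0, ← ENNReal.ofReal_natCast, ← ENNReal.ofReal_natCast,
    ← ENNReal.ofReal_pow hl0.le, ← ENNReal.ofReal_inv_of_pos (by positivity),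
    ← ENNReal.ofReal_mul (by positivity), ← ENNReal.ofReal_mul (by positivity)]
  congr 1
  rw [pow_add, div_pow]
  field_simp

theorem tsum_pow_mul_inv_pow (hx0 : 0 ≤ x) (hx : x < 1) {l : ℕ} (hl : 0 < l) (e : ℕ) :
    ∑' s : ℕ, ENNReal.ofReal x ^ s * ((l : ENNReal) ^ (s + e))⁻¹ =
      ENNReal.ofReal (1 / (l : ℝ) ^ e * (1 / (1 - x / l))) := by
  simpa using tsum_choose_mul_pow_mul_inv_pow hx0 hx hl 0 e

theorem tsum_pow_mul_inv_pow_add_two (hx0 : 0 ≤ x) (hx : x < 1) {l : ℕ} (hl : 0 < l) :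
    ∑' s : ℕ, ENNReal.ofReal x ^ s * ((l : ENNReal) ^ (s + 2))⁻¹ =
      ENNReal.ofReal (1 / (l * (l - x))) := by
  have hl' : (1 : ℝ) ≤ l := by exact_mod_cast hl
  have h : (l : ℝ) - x ≠ 0 := by linarith
  rw [tsum_pow_mul_inv_pow hx0 hx hl]
  congr 1
  field_simp

theorem ENNReal.tsum_Ioo_succ (f : ℕ → ENNReal) {m n : ℕ} (h : m < n) :
    ∑' l : Set.Ioo m (n + 1), f l = ∑' l : Set.Ioo m n, f l + f n := by
  have h1 : ∀ n, ∑' l : Set.Ioo m n, f l = ∑ l ∈ Finset.Ico (m + 1) n, f l := fun n => by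
    rw [← Finset.tsum_subtype', show ((Finset.Ico (m + 1) n : Finset ℕ) : Set ℕ) = Set.Ioo m n by
      ext l
      simp]
  rw [h1, h1, Finset.sum_Ico_succ_top (Nat.succ_le_of_lt h)]

/-- Both sides are `∏ j/(j-x)` over `m < j ≤ m + d`: admitting a new largest index `j` multiplies
the generating function by `1 + x/(j-x)`. -/
theorem nestedGen_Ioo (hx0 : 0 ≤ x) (hx : x < 1) (m d : ℕ) :
    nestedGen (ENNReal.ofReal x) (Set.Ioo m (m + d + 1)) =
      ENNReal.ofReal (gammaKernel x (m + d) 0 / gammaKernel x m 0) := by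
  have rec_eq : ∀ n, nestedGen (ENNReal.ofReal x) (Set.Ioo m n) = 1 + ∑' k : Set.Ioo m n,
      nestedGen (ENNReal.ofReal x) (Set.Ioo m (k : ℕ)) *
        (ENNReal.ofReal x * ∑' s : ℕ, ENNReal.ofReal x ^ s *
          (((k : ℕ) : ENNReal) ^ (s + 1))⁻¹) := fun n => by
    rw [nestedGen_eq_one_add]
    congr 1
    refine tsum_congr fun k => ?_
    rw [Set.Ioo_inter_Iio, min_eq_right k.2.2.le]
  induction d with
  | zero =>
    rw [rec_eq, add_zero, div_self (gammaKernel_pos hx m 0).ne', ENNReal.ofReal_one,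
      ENNReal.tsum_eq_zero.2 fun k => absurd k.2.2 (by have := k.2.1; omega), add_zero]
  | succ d ih =>
    rw [rec_eq, ENNReal.tsum_Ioo_succ (fun k => nestedGen (ENNReal.ofReal x) (Set.Ioo m k) *
        (ENNReal.ofReal x * ∑' s : ℕ, ENNReal.ofReal x ^ s * ((k : ENNReal) ^ (s + 1))⁻¹))
        (show m < m + (d + 1) by omega), ← add_assoc, ← rec_eq, ← add_assoc, ih,
      tsum_pow_mul_inv_pow hx0 hx (Nat.succ_pos _), ← ENNReal.ofReal_mul hx0]
    have h1 := gammaKernel_pos hx m 0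
    have h2 := gammaKernel_pos hx (m + d) 0
    have hm : (0 : ℝ) ≤ m := m.cast_nonneg
    have hd : (0 : ℝ) ≤ d := d.cast_nonneg
    have h3 : 0 < (m : ℝ) + d + 1 - x := by linarith
    have h4 : 1 - x / ((m : ℝ) + d + 1) = ((m : ℝ) + d + 1 - x) / (m + d + 1) := by
      field_simp
    have h5 : 0 ≤ x * (1 / (((m + d).succ : ℕ) : ℝ) ^ 1 * (1 / (1 - x / ((m + d).succ : ℕ)))) := by
      push_cast
      rw [h4]
      positivity
    rw [← ENNReal.ofReal_mul (by positivity), ← ENNReal.ofReal_add (by positivity)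
      (mul_nonneg (by positivity) h5), gammaKernel_succ_left]
    congr 1
    push_cast
    rw [h4, zero_add]
    field_simp
    ring

theorem nestedGen_Ioo_mul (hx0 : 0 ≤ x) (hx : x < 1) {m k : ℕ} (h : m < k) :
    nestedGen (ENNReal.ofReal x) (Set.Ioo m k) *
        ∑' s : ℕ, ENNReal.ofReal x ^ s * ((k : ENNReal) ^ (s + 2))⁻¹ =
      ENNReal.ofReal (gammaKernel x k 0 / gammaKernel x m 0 / (k : ℝ) ^ 2) := by
  obtain ⟨d, rfl⟩ := Nat.exists_eq_add_of_lt h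
  have h1 := gammaKernel_pos hx m 0
  have h2 := gammaKernel_pos hx (m + d) 0
  have hm : (0 : ℝ) ≤ m := m.cast_nonneg
  have hd : (0 : ℝ) ≤ d := d.cast_nonneg
  have h3 : 0 < (m : ℝ) + d + 1 - x := by linarith
  rw [nestedGen_Ioo hx0 hx, tsum_pow_mul_inv_pow_add_two hx0 hx (Nat.succ_pos _),
    ← ENNReal.ofReal_mul (by positivity), gammaKernel_succ_left]
  congr 1
  push_cast
  rw [zero_add]
  field_simp

/-- The product is split according to `k < l`, `k > l` or `k = l`. -/
theorem ENNReal.tsum_Ioi_mul_tsum_Ioi (f g : ℕ → ENNReal) (m : ℕ) :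
    (∑' k : Set.Ioi m, f k) * ∑' l : Set.Ioi m, g l =
      ∑' k : Set.Ioi m, f k * ∑' l : Set.Ioi (k : ℕ), g l +
        ∑' k : Set.Ioi m, g k * ∑' l : Set.Ioi (k : ℕ), f l + ∑' k : Set.Ioi m, f k * g k := by
  have split : ∀ k, m < k → ∑' l : Set.Ioi m, g l =
      ∑' l : Set.Ioi k, g l + ∑' l : Set.Ioo m k, g l + g k := fun k hk => by
    have hd : Disjoint (Set.Ioo m (k + 1)) (Set.Ioi k) :=
      Set.disjoint_left.2 fun l h1 h2 => by
        have := h1.2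
        simp only [Set.mem_Ioi] at h2
        omega
    have hu : Set.Ioi m = Set.Ioo m (k + 1) ∪ Set.Ioi k := by
      ext l
      simp only [Set.mem_Ioi, Set.mem_union, Set.mem_Ioo]
      omega
    rw [add_assoc, ← ENNReal.tsum_Ioo_succ g hk, add_comm, hu]
    exact ENNReal.summable.tsum_union_disjoint hd ENNReal.summable
  rw [← ENNReal.tsum_mul_right]
  have h : ∀ k : Set.Ioi m, f k * ∑' l : Set.Ioi m, g l =
      f k * ∑' l : Set.Ioi (k : ℕ), g l + ∑' l : Set.Ioo m (k : ℕ), g l * f k + f k * g k :=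
    fun k => by
      rw [split k k.2, ENNReal.tsum_mul_right]
      ring
  rw [tsum_congr h, ENNReal.tsum_add, ENNReal.tsum_add,
    tsum_tsum_Ioo_comm (fun l k => g l * f k)]
  simp only [ENNReal.tsum_mul_left]

theorem tsum_choose_mul_nestedSum_singleton (hx0 : 0 ≤ x) (hx : x < 1) (j e : ℕ) :
    ∑' p : ℕ, ENNReal.ofReal x ^ p *
        (((p + j).choose j : ENNReal) * nestedSum (Set.Ioi 0) ![p + e]) =
      ∑' l : Set.Ioi 0,
        ENNReal.ofReal (1 / ((l : ℕ) : ℝ) ^ e * (1 / (1 - x / (l : ℕ)) ^ (j + 1))) := by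
  simp only [nestedSum_singleton, ← ENNReal.tsum_mul_left]
  rw [ENNReal.tsum_comm]
  exact tsum_congr fun l => tsum_choose_mul_pow_mul_inv_pow hx0 hx (pos_of_mem_Ioi l) j e

theorem ENNReal.tsum_mul_tsum_eq_tsum_sum_antidiagonal (f g : ℕ → ENNReal) :
    (∑' m, f m) * ∑' n, g n =
      ∑' p, ∑ mn ∈ Finset.HasAntidiagonal.antidiagonal p, f mn.1 * g mn.2 := by
  rw [← ENNReal.tsum_mul_right]
  simp only [← ENNReal.tsum_mul_left]
  rw [← ENNReal.tsum_prod (f := fun m n => f m * g n),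
    ← Finset.HasAntidiagonal.sigmaAntidiagonalEquivProd.tsum_eq, ENNReal.tsum_sigma']
  refine tsum_congr fun p => ?_
  rw [← Finset.tsum_subtype]
  rfl

theorem tsum_Ioi_one_div_mul_sub (hx0 : 0 ≤ x) (hx : x < 1) :
    ∑' l : Set.Ioi 0, ENNReal.ofReal (1 / ((l : ℕ) * ((l : ℕ) - x))) =
      ∑' p : ℕ, ENNReal.ofReal x ^ p * nestedSum (Set.Ioi 0) ![p + 2] := by
  have h := tsum_choose_mul_nestedSum_singleton hx0 hx 0 2
  simp only [Nat.choose_zero_right, Nat.cast_one, one_mul] at h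
  rw [h]
  refine tsum_congr fun l => ?_
  have hl : (0 : ℝ) < (l : ℕ) := by exact_mod_cast pos_of_mem_Ioi l
  have hlx := (sub_pos_of_mem_Ioi hx l).ne'
  congr 1
  simp only [Nat.reduceAdd, pow_one]
  field_simp

theorem tsum_Ioi_one_div_sub_sq (hx0 : 0 ≤ x) (hx : x < 1) :
    ∑' l : Set.Ioi 0, ENNReal.ofReal (1 / ((l : ℕ) - x) ^ 2) =
      ∑' p : ℕ, ENNReal.ofReal x ^ p * (((p + 1 : ℕ) : ENNReal) *
        nestedSum (Set.Ioi 0) ![p + 2]) := by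
  have h := tsum_choose_mul_nestedSum_singleton hx0 hx 1 2
  simp only [Nat.choose_one_right] at h
  rw [h]
  refine tsum_congr fun l => ?_
  have hl : (0 : ℝ) < (l : ℕ) := by exact_mod_cast pos_of_mem_Ioi l
  have hlx := (sub_pos_of_mem_Ioi hx l).ne'
  congr 1
  simp only [Nat.reduceAdd]
  field_simp

theorem tsum_Ioi_one_div_mul_sub_mul (hx0 : 0 ≤ x) (hx : x < 1) :
    ∑' l : Set.Ioi 0, ENNReal.ofReal (1 / ((l : ℕ) * ((l : ℕ) - x))) *
        ENNReal.ofReal (1 / ((l : ℕ) - x) ^ 2) =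
      ∑' p : ℕ, ENNReal.ofReal x ^ p * (((p + 2).choose 2 : ENNReal) *
        nestedSum (Set.Ioi 0) ![p + 4]) := by
  rw [tsum_choose_mul_nestedSum_singleton hx0 hx 2 4]
  refine tsum_congr fun l => ?_
  have hl : (0 : ℝ) < (l : ℕ) := by exact_mod_cast pos_of_mem_Ioi l
  have hlx := sub_pos_of_mem_Ioi hx l
  rw [← ENNReal.ofReal_mul (by positivity)]
  congr 1
  simp only [Nat.reduceAdd]
  field_simp

/-- The diagonal term stands on the left so that no subtraction occurs in `ENNReal`. -/
theorem tsum_generating (hx0 : 0 ≤ x) (hx : x ≤ 1 / 2) :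
    ∑' p : ℕ, ENNReal.ofReal x ^ p * ((∑ t ∈ Finset.Nat.antidiagonalTuple 3 p,
        ((∑ α ∈ posTuples (t 0 + 1) (t 0 + t 1 + 1), nestedSum (Set.Ioi 0)
          (Fin.snoc (bumpLast α) (t 2 + 2) : Fin (t 0 + 1 + 1) → ℕ)) +
        ∑ β ∈ posTuples (t 1 + 1) (t 1 + t 2 + 1), nestedSum (Set.Ioi 0)
          (Fin.cons (t 0 + 2) (bumpLast β) : Fin (t 1 + 1 + 1) → ℕ))) +
        ((p + 2).choose 2 : ENNReal) * nestedSum (Set.Ioi 0) ![p + 4]) =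
      ∑' p : ℕ, ENNReal.ofReal x ^ p * ∑ mn ∈ Finset.HasAntidiagonal.antidiagonal p,
        nestedSum (Set.Ioi 0) ![mn.1 + 2] *
          (((mn.2 + 1 : ℕ) : ENNReal) * nestedSum (Set.Ioi 0) ![mn.2 + 2]) := by
  have hx1 : x < 1 := by linarith
  have hG := tsum_Ioi_one_div_mul_sub hx0 hx1
  simp only [mul_add, Finset.sum_add_distrib, ENNReal.tsum_add]
  rw [tsum_nestedSum_snoc_bumpLast, tsum_nestedSum_cons_bumpLast,
    ← tsum_Ioi_one_div_mul_sub_mul hx0 hx1]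
  have hu : ∀ (q : ℕ) (l : Set.Ioi q), ∑' c : ℕ, ENNReal.ofReal x ^ c *
      (((l : ℕ) : ENNReal) ^ (c + 2))⁻¹ = ENNReal.ofReal (1 / ((l : ℕ) * ((l : ℕ) - x))) :=
    fun q l => tsum_pow_mul_inv_pow_add_two hx0 hx1 (pos_of_mem_Ioi l)
  have hA : ∀ k : Set.Ioi 0, (nestedGen (ENNReal.ofReal x) (Set.Ioo 0 (k : ℕ)) *
        ∑' s : ℕ, ENNReal.ofReal x ^ s * (((k : ℕ) : ENNReal) ^ (s + 2))⁻¹) *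
        ∑' l : Set.Ioi (k : ℕ), ∑' c : ℕ, ENNReal.ofReal x ^ c *
          (((l : ℕ) : ENNReal) ^ (c + 2))⁻¹ =
      ENNReal.ofReal (gammaKernel x k 0 / ((k : ℕ) : ℝ) ^ 2) *
        ∑' l : Set.Ioi (k : ℕ), ENNReal.ofReal (1 / ((l : ℕ) * ((l : ℕ) - x))) := fun k => by
    rw [nestedGen_Ioo_mul hx0 hx1 k.2, gammaKernel_zero_left, div_one, tsum_congr (hu k)]
  have hB : ∀ m : Set.Ioi 0, (∑' c : ℕ, ENNReal.ofReal x ^ c *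
        (((m : ℕ) : ENNReal) ^ (c + 2))⁻¹) *
        ∑' k : Set.Ioi (m : ℕ), nestedGen (ENNReal.ofReal x) (Set.Ioo (m : ℕ) (k : ℕ)) *
          ∑' s : ℕ, ENNReal.ofReal x ^ s * (((k : ℕ) : ENNReal) ^ (s + 2))⁻¹ =
      ENNReal.ofReal (1 / ((m : ℕ) * ((m : ℕ) - x))) * ∑' k : Set.Ioi (m : ℕ),
          ENNReal.ofReal (gammaKernel x k 0 / gammaKernel x m 0 / ((k : ℕ) : ℝ) ^ 2) := fun m => by
    rw [hu 0 m, tsum_congr fun k : Set.Ioi (m : ℕ) => nestedGen_Ioo_mul hx0 hx1 k.2]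
  rw [tsum_congr hA, tsum_congr hB, tsum_gammaKernel_zero_mul_tsum hx0 hx,
    tsum_mul_tsum_gammaKernel_zero hx0 hx,
    ← ENNReal.tsum_Ioi_mul_tsum_Ioi (fun k => ENNReal.ofReal (1 / ((k : ℝ) * (k - x))))
      (fun k => ENNReal.ofReal (1 / ((k : ℝ) - x) ^ 2)) 0,
    tsum_Ioi_one_div_mul_sub hx0 hx1, tsum_Ioi_one_div_sub_sq hx0 hx1,
    ENNReal.tsum_mul_tsum_eq_tsum_sum_antidiagonal]
  refine tsum_congr fun p => ?_
  rw [Finset.mul_sum]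
  refine Finset.sum_congr rfl fun mn hmn => ?_
  rw [← Finset.HasAntidiagonal.mem_antidiagonal.1 hmn, pow_add]
  ring

theorem tsum_generating_ne_top (hx0 : 0 ≤ x) (hx : x ≤ 1 / 2) :
    ∑' p : ℕ, ENNReal.ofReal x ^ p * ∑ mn ∈ Finset.HasAntidiagonal.antidiagonal p,
        nestedSum (Set.Ioi 0) ![mn.1 + 2] *
          (((mn.2 + 1 : ℕ) : ENNReal) * nestedSum (Set.Ioi 0) ![mn.2 + 2]) ≠ ⊤ := by
  have hx1 : x < 1 := by linarith
  -- The constant 4 comes from `l - x ≥ l/2`, valid for `l ≥ 1` and `x ≤ 1/2`.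
  have hsum : ∑' l : ℕ, ENNReal.ofReal (4 * (1 / (l : ℝ) ^ 2)) ≠ ⊤ :=
    ((Real.summable_one_div_nat_pow.2 one_lt_two).mul_left 4).tsum_ofReal_ne_top
  have hfin : ∀ f : Set.Ioi 0 → ℝ, (∀ l : Set.Ioi 0, f l ≤ 4 * (1 / ((l : ℕ) : ℝ) ^ 2)) →
      ∑' l : Set.Ioi 0, ENNReal.ofReal (f l) ≠ ⊤ := fun f hf => by
    refine ne_top_of_le_ne_top hsum (le_trans (ENNReal.tsum_le_tsum fun l =>
      ENNReal.ofReal_le_ofReal (hf l)) ?_)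
    exact ENNReal.tsum_comp_le_tsum_of_injective Subtype.val_injective
      (fun l : ℕ => ENNReal.ofReal (4 * (1 / (l : ℝ) ^ 2)))
  have hG := hfin (fun l => 1 / ((l : ℕ) * ((l : ℕ) - x))) fun l => by
    have hl : (1 : ℝ) ≤ (l : ℕ) := by exact_mod_cast pos_of_mem_Ioi l
    have hlx := sub_pos_of_mem_Ioi hx1 l
    rw [mul_one_div, div_le_div_iff₀ (by positivity) (by positivity)]
    nlinarith
  have hV := hfin (fun l => 1 / ((l : ℕ) - x) ^ 2) fun l => by
    have hl : (1 : ℝ) ≤ (l : ℕ) := by exact_mod_cast pos_of_mem_Ioi l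
    have hlx := sub_pos_of_mem_Ioi hx1 l
    rw [mul_one_div, div_le_div_iff₀ (by positivity) (by positivity)]
    nlinarith
  rw [tsum_Ioi_one_div_mul_sub hx0 hx1] at hG
  rw [tsum_Ioi_one_div_sub_sq hx0 hx1] at hV
  refine ne_of_eq_of_ne ?_ (ENNReal.mul_ne_top hG hV)
  rw [ENNReal.tsum_mul_tsum_eq_tsum_sum_antidiagonal]
  refine tsum_congr fun p => ?_
  rw [Finset.mul_sum]
  refine Finset.sum_congr rfl fun mn hmn => ?_
  rw [← Finset.HasAntidiagonal.mem_antidiagonal.1 hmn, pow_add]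
  ring

end

/-! ### Symmetrization and comparison of coefficients -/

/-- Swapping `m` and `n` replaces the weight `n + 1` by `m + 1`, and the average of the two is `(p +
2)/2`. -/
theorem sum_antidiagonal_succ_mul (z : ℕ → ℝ) (p : ℕ) :
    ∑ mn ∈ Finset.HasAntidiagonal.antidiagonal p, z mn.1 * (((mn.2 + 1 : ℕ) : ℝ) * z mn.2) =
      ((p : ℝ) + 2) / 2 * ∑ mn ∈ Finset.HasAntidiagonal.antidiagonal p, z mn.1 * z mn.2 := by
  have h := Finset.Nat.sum_antidiagonal_swap
    (n := p) (f := fun mn : ℕ × ℕ => z mn.1 * (((mn.2 + 1 : ℕ) : ℝ) * z mn.2))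
  have h2 : ∑ mn ∈ Finset.HasAntidiagonal.antidiagonal p,
      z mn.1 * (((mn.2 + 1 : ℕ) : ℝ) * z mn.2) +
      ∑ mn ∈ Finset.HasAntidiagonal.antidiagonal p,
        z mn.2 * (((mn.1 + 1 : ℕ) : ℝ) * z mn.1) =
      ((p : ℝ) + 2) * ∑ mn ∈ Finset.HasAntidiagonal.antidiagonal p, z mn.1 * z mn.2 := by
    rw [← Finset.sum_add_distrib, Finset.mul_sum]
    refine Finset.sum_congr rfl fun mn hmn => ?_
    rw [← Finset.HasAntidiagonal.mem_antidiagonal.1 hmn]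
    push_cast
    ring
  simp only [Prod.fst_swap, Prod.snd_swap] at h
  rw [h] at h2
  linarith

theorem one_le_bumpLast {a : ℕ} {α : Fin (a + 1) → ℕ} (h : ∀ i, 1 ≤ α i) (i : Fin (a + 1)) :
    1 ≤ bumpLast α i := by
  rw [bumpLast, Function.update_apply]
  split_ifs
  · exact Nat.le_add_left _ _
  · exact h i

theorem two_le_bumpLast_last {a : ℕ} {α : Fin (a + 1) → ℕ} (h : ∀ i, 1 ≤ α i) :
    2 ≤ bumpLast α (Fin.last a) := by
  rw [bumpLast, Function.update_self]
  exact Nat.succ_le_succ (h _)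

theorem ofReal_multiZeta_singleton (s : ℕ) :
    ENNReal.ofReal (multiZeta ![s + 2]) = nestedSum (Set.Ioi 0) ![s + 2] :=
  ofReal_multiZeta (fun i => by fin_cases i; simp) (by simp)

theorem ofReal_multiZeta_snoc_bumpLast {a : ℕ} {α : Fin (a + 1) → ℕ} (h : ∀ i, 1 ≤ α i) (c : ℕ) :
    ENNReal.ofReal (multiZeta (Fin.snoc (bumpLast α) (c + 2) : Fin (a + 1 + 1) → ℕ)) =
      nestedSum (Set.Ioi 0) (Fin.snoc (bumpLast α) (c + 2) : Fin (a + 1 + 1) → ℕ) := by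
  refine ofReal_multiZeta (fun i => ?_) (by rw [Fin.snoc_last]; exact Nat.le_add_left _ _)
  induction i using Fin.lastCases with
  | last => rw [Fin.snoc_last]; exact Nat.le_add_left _ _
  | cast i => rw [Fin.snoc_castSucc]; exact one_le_bumpLast h i

theorem ofReal_multiZeta_cons_bumpLast {a : ℕ} {α : Fin (a + 1) → ℕ} (h : ∀ i, 1 ≤ α i) (c : ℕ) :
    ENNReal.ofReal (multiZeta (Fin.cons (c + 2) (bumpLast α) : Fin (a + 1 + 1) → ℕ)) =
      nestedSum (Set.Ioi 0) (Fin.cons (c + 2) (bumpLast α) : Fin (a + 1 + 1) → ℕ) := by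
  refine ofReal_multiZeta (fun i => ?_) ?_
  · induction i using Fin.cases with
    | zero => rw [Fin.cons_zero]; exact Nat.le_add_left _ _
    | succ i => rw [Fin.cons_succ]; exact one_le_bumpLast h i
  · rw [← Fin.succ_last, Fin.cons_succ]
    exact two_le_bumpLast_last h

theorem mainTheorem4 (p : ℕ) :
    (∑ t ∈ Finset.Nat.antidiagonalTuple 3 p,
      ((∑ α ∈ posTuples (t 0 + 1) (t 0 + t 1 + 1),
          multiZeta (Fin.snoc (bumpLast α) (t 2 + 2) : Fin (t 0 + 1 + 1) → ℕ)) +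
        ∑ β ∈ posTuples (t 1 + 1) (t 1 + t 2 + 1),
          multiZeta (Fin.cons (t 0 + 2) (bumpLast β) : Fin (t 1 + 1 + 1) → ℕ))) =
      ((p : ℝ) + 2) / 2 *
          (∑ mn ∈ Finset.HasAntidiagonal.antidiagonal p, multiZeta ![mn.1 + 2] * multiZeta ![mn.2 + 2]) -
        ((p : ℝ) + 1) * ((p : ℝ) + 2) / 2 * multiZeta ![p + 4] := by
  have hz := fun {r : ℕ} (α : Fin r → ℕ) => multiZeta_nonneg α
  have hsum := fun {r n : ℕ} (g : (Fin r → ℕ) → ℝ) (hg : ∀ α, 0 ≤ g α) =>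
    Finset.sum_nonneg (s := posTuples r n) fun α _ => hg α
  -- The `ζ(p+4)` term is carried on the left to keep both coefficient sequences nonnegative; `r =
  -- 1/2` is the range in which the transport is available.
  have key := eq_of_tsum_ofReal_pow_mul_eq (r := 1 / 2)
    (a := fun p => (∑ t ∈ Finset.Nat.antidiagonalTuple 3 p,
      ((∑ α ∈ posTuples (t 0 + 1) (t 0 + t 1 + 1),
          multiZeta (Fin.snoc (bumpLast α) (t 2 + 2) : Fin (t 0 + 1 + 1) → ℕ)) +
        ∑ β ∈ posTuples (t 1 + 1) (t 1 + t 2 + 1),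
          multiZeta (Fin.cons (t 0 + 2) (bumpLast β) : Fin (t 1 + 1 + 1) → ℕ))) +
      ((p + 2).choose 2 : ℝ) * multiZeta ![p + 4])
    (b := fun p => ∑ mn ∈ Finset.HasAntidiagonal.antidiagonal p,
      multiZeta ![mn.1 + 2] * (((mn.2 + 1 : ℕ) : ℝ) * multiZeta ![mn.2 + 2]))
    (fun p => add_nonneg (Finset.sum_nonneg fun t _ => add_nonneg (hsum _ fun _ => hz _)
      (hsum _ fun _ => hz _)) (mul_nonneg (Nat.cast_nonneg _) (hz _)))
    (fun p => Finset.sum_nonneg fun mn _ =>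
      mul_nonneg (hz _) (mul_nonneg (Nat.cast_nonneg _) (hz _)))
    (by norm_num)
  have ha : ∀ p, ENNReal.ofReal ((∑ t ∈ Finset.Nat.antidiagonalTuple 3 p,
      ((∑ α ∈ posTuples (t 0 + 1) (t 0 + t 1 + 1),
          multiZeta (Fin.snoc (bumpLast α) (t 2 + 2) : Fin (t 0 + 1 + 1) → ℕ)) +
        ∑ β ∈ posTuples (t 1 + 1) (t 1 + t 2 + 1),
          multiZeta (Fin.cons (t 0 + 2) (bumpLast β) : Fin (t 1 + 1 + 1) → ℕ))) +
      ((p + 2).choose 2 : ℝ) * multiZeta ![p + 4]) =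
      (∑ t ∈ Finset.Nat.antidiagonalTuple 3 p,
        ((∑ α ∈ posTuples (t 0 + 1) (t 0 + t 1 + 1), nestedSum (Set.Ioi 0)
          (Fin.snoc (bumpLast α) (t 2 + 2) : Fin (t 0 + 1 + 1) → ℕ)) +
        ∑ β ∈ posTuples (t 1 + 1) (t 1 + t 2 + 1), nestedSum (Set.Ioi 0)
          (Fin.cons (t 0 + 2) (bumpLast β) : Fin (t 1 + 1 + 1) → ℕ))) +
        ((p + 2).choose 2 : ENNReal) * nestedSum (Set.Ioi 0) ![p + 4] := fun p => by
    rw [ENNReal.ofReal_add (Finset.sum_nonneg fun t _ => add_nonneg (hsum _ fun _ => hz _)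
      (hsum _ fun _ => hz _)) (mul_nonneg (Nat.cast_nonneg _) (hz _)),
      ENNReal.ofReal_sum_of_nonneg fun t _ => add_nonneg (hsum _ fun _ => hz _)
      (hsum _ fun _ => hz _), ENNReal.ofReal_mul (Nat.cast_nonneg _), ENNReal.ofReal_natCast,
      ofReal_multiZeta_singleton (p + 2)]
    congr 1
    refine Finset.sum_congr rfl fun t _ => ?_
    rw [ENNReal.ofReal_add (hsum _ fun _ => hz _) (hsum _ fun _ => hz _),
      ENNReal.ofReal_sum_of_nonneg fun _ _ => hz _, ENNReal.ofReal_sum_of_nonneg fun _ _ => hz _]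
    congr 1
    · exact Finset.sum_congr rfl fun α hα =>
        ofReal_multiZeta_snoc_bumpLast ((mem_posTuples α).1 hα).2 _
    · exact Finset.sum_congr rfl fun β hβ =>
        ofReal_multiZeta_cons_bumpLast ((mem_posTuples β).1 hβ).2 _
  have hb : ∀ p, ENNReal.ofReal (∑ mn ∈ Finset.HasAntidiagonal.antidiagonal p,
      multiZeta ![mn.1 + 2] * (((mn.2 + 1 : ℕ) : ℝ) * multiZeta ![mn.2 + 2])) =
      ∑ mn ∈ Finset.HasAntidiagonal.antidiagonal p, nestedSum (Set.Ioi 0) ![mn.1 + 2] *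
        (((mn.2 + 1 : ℕ) : ENNReal) * nestedSum (Set.Ioi 0) ![mn.2 + 2]) := fun p => by
    rw [ENNReal.ofReal_sum_of_nonneg fun mn _ =>
      mul_nonneg (hz _) (mul_nonneg (Nat.cast_nonneg _) (hz _))]
    refine Finset.sum_congr rfl fun mn _ => ?_
    rw [ENNReal.ofReal_mul (hz _), ENNReal.ofReal_mul (Nat.cast_nonneg _), ENNReal.ofReal_natCast,
      ofReal_multiZeta_singleton, ofReal_multiZeta_singleton]
  simp only [ha, hb] at key
  have hp := congrFun (key (fun x hx0 hx => tsum_generating hx0.le hx)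
    (tsum_generating_ne_top (by norm_num) le_rfl)) p
  rw [sum_antidiagonal_succ_mul (fun n => multiZeta ![n + 2]), Nat.cast_choose_two] at hp
  push_cast at hp
  linear_combination hp
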